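/- Let $1\le n\le N$ be integers and let $\langle A,B\rangle=\operatorname{Tr}(A^{T}B)$ on $\mathbb{R}^{n\times N}$. Let $V(n,N)=\{Q\in\mathbb{R}^{n\times N} : QQ^{T}=I_n\}$ be the Stiefel manifold, and let $$W^0_{n,N}=\{(Q,P_0)\in\mathbb{R}^{n\times N}\times\mathbb{R}^{n\times N} : QQ^{T}=I_n,\ QP_0^{T}+P_0Q^{T}=0\},$$ a smooth submanifold of $\mathbb{R}^{n\times N}\times\mathbb{R}^{n\times N}$, equipped with the two-form $\Omega$ that is the restriction of $\omega((A_1,A_2),(B_1,B_2))=\langle A_1,B_2\rangle-\langle A_2,B_1\rangle$. Let $T^*V(n,N)$ be the cotangent bundle of $V(n,N)$ with its canonical two-form $\omega_c=-d\theta$, where $\theta$ is the tautological one-form $\theta_p(X)=p(\pi_*X)$ and $\pi:T^*V(n,N)\to V(n,N)$ is the projection. For $Q\in V(n,N)$ and $S\in\mathbb{R}^{n\times N}$, write $(Q,S)$ for the point of $T^*V(n,N)$ given by the covector $\langle S,\cdot\rangle$ on $T_QV(n,N)\subset\mathbb{R}^{n\times N}$. Then $\Omega$ and $\omega_c$ are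 symplectic forms (smooth, closed and nondegenerate), and the map $$\Phi:(W^0_{n,N},\Omega)\to(T^*V(n,N),\omega_c),\qquad \Phi(Q,P_0)=(Q,Q\bar M),$$ $$\bar M=-\tfrac12 Q^{T}(P_0Q^{T}-QP_0^{T})Q+Q^{T}P_0-P_0^{T}Q,$$ is a symplectomorphism, that is, a smooth ($C^\infty$) diffeomorphism with $\Phi^*\omega_c=\Omega$. -/

import Mathlib

open Set Bundle Matrix
open scoped Manifold ContDiff

noncomputable section

/-! ### Regular level sets are smooth manifolds -/

section LevelSet

variable {E G : Type*} [NormedAddCommGroup E] [NormedSpace ℝ E] [FiniteDimensional ℝ E]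
  [NormedAddCommGroup G] [NormedSpace ℝ G] [FiniteDimensional ℝ G]

/-- The model space of a level set of a submersion `E → G`: the Euclidean space of dimension
`dim E - dim G`. -/
abbrev LevelModel (E G : Type*) [NormedAddCommGroup E] [NormedSpace ℝ E]
    [NormedAddCommGroup G] [NormedSpace ℝ G] : Type :=
  EuclideanSpace ℝ (Fin (Module.finrank ℝ E - Module.finrank ℝ G))

/-- `S` is the zero set of the smooth map `F`, and `0` is a regular value of `F`. -/
structure IsRegularLevelSet (F : E → G) (S : Set E) : Prop where
  smooth : ContDiff ℝ ∞ F
  mem_iff : ∀ x, x ∈ S ↔ F x = 0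
  surj : ∀ x ∈ S, Function.Surjective (fderiv ℝ F x)

theorem exists_equiv_prod_of_surjective (A : E →L[ℝ] G) (hA : Function.Surjective A) :
    ∃ e : E ≃L[ℝ] (G × LevelModel E G), ∀ v, (e v).1 = A v := by
  have hker : Module.finrank ℝ (LinearMap.ker A.toLinearMap) =
      Module.finrank ℝ E - Module.finrank ℝ G := by
    have h1 := LinearMap.finrank_range_add_finrank_ker A.toLinearMap
    rw [LinearMap.range_eq_top.2 hA, finrank_top] at h1
    omega
  have hle : Module.finrank ℝ G ≤ Module.finrank ℝ E :=
    LinearMap.finrank_le_finrank_of_surjective (f := A.toLinearMap) hA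
  obtain ⟨p, hp⟩ := LinearMap.exists_leftInverse_of_injective
    (LinearMap.ker A.toLinearMap).subtype (by simp)
  let L : LinearMap.ker A.toLinearMap ≃ₗ[ℝ] LevelModel E G :=
    LinearEquiv.ofFinrankEq _ _ (by rw [hker]; simp)
  let T : E →ₗ[ℝ] (G × LevelModel E G) := A.toLinearMap.prod (L.toLinearMap ∘ₗ p)
  have hT : Function.Injective T := by
    rw [injective_iff_map_eq_zero]
    intro v hv
    have h1 : A v = 0 := congrArg Prod.fst hv
    have h2 : L (p v) = 0 := congrArg Prod.snd hv
    have h3 : p v = 0 := by simpa using h2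
    have h4 := LinearMap.congr_fun hp ⟨v, h1⟩
    simp only [LinearMap.coe_comp, Function.comp_apply, Submodule.coe_subtype, h3,
      LinearMap.id_coe, id_eq] at h4
    exact (congrArg Subtype.val h4).symm
  refine ⟨(LinearEquiv.ofInjectiveOfFinrankEq T hT ?_).toContinuousLinearEquiv, fun v => rfl⟩
  simp
  omega

/-- Around a point of a regular level set there are smooth ambient coordinates whose first
component is the defining function. -/
theorem IsRegularLevelSet.exists_ambientChart {F : E → G} {S : Set E} (h : IsRegularLevelSet F S)
    (x : S) : ∃ φ : OpenPartialHomeomorph E (G × LevelModel E G), (x : E) ∈ φ.source ∧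
      (∀ y ∈ φ.source, (φ y).1 = F y) ∧ ContDiffOn ℝ ∞ φ φ.source ∧
      ContDiffOn ℝ ∞ φ.symm φ.target := by
  obtain ⟨e, he⟩ := exists_equiv_prod_of_surjective (fderiv ℝ F x) (h.surj x x.2)
  let Ψ : E → G × LevelModel E G := fun y => (F y, (e y).2)
  have hΨ : ContDiff ℝ ∞ Ψ := h.smooth.prodMk (contDiff_snd.comp e.contDiff)
  have hF : HasFDerivAt F (fderiv ℝ F x) x :=
    (h.smooth.differentiable (by simp) x).hasFDerivAt
  have hd : HasFDerivAt Ψ (e : E →L[ℝ] (G × LevelModel E G)) (x : E) := by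
    have h2 := hF.prodMk (((ContinuousLinearMap.snd ℝ G (LevelModel E G)).comp
      (e : E →L[ℝ] (G × LevelModel E G))).hasFDerivAt (x := (x : E)))
    have h3 : (e : E →L[ℝ] (G × LevelModel E G)) = (fderiv ℝ F x).prod
        ((ContinuousLinearMap.snd ℝ G (LevelModel E G)).comp
          (e : E →L[ℝ] (G × LevelModel E G))) := by
      ext1 v
      exact Prod.ext (he v) rfl
    rw [h3]
    exact h2
  let φ₀ := hΨ.contDiffAt.toOpenPartialHomeomorph Ψ hd (by simp)
  let U : Set E := (fderiv ℝ Ψ) ⁻¹' range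
    ((↑) : (E ≃L[ℝ] (G × LevelModel E G)) → E →L[ℝ] (G × LevelModel E G))
  have hU : IsOpen U :=
    ContinuousLinearEquiv.isOpen.preimage (hΨ.continuous_fderiv (by simp))
  refine ⟨φ₀.restrOpen U hU, ⟨hΨ.contDiffAt.mem_toOpenPartialHomeomorph_source hd (by simp),
    ⟨e, hd.fderiv.symm⟩⟩, fun y _ => rfl, hΨ.contDiffOn, ?_⟩
  intro y hy
  have hy' : (φ₀.restrOpen U hU).symm y ∈ (φ₀.restrOpen U hU).source :=
    (φ₀.restrOpen U hU).map_target hy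
  obtain ⟨f, hf⟩ := hy'.2
  refine ((φ₀.restrOpen U hU).contDiffAt_symm (f₀' := f) hy ?_ ?_).contDiffWithinAt
  · rw [hf]
    exact (hΨ.differentiable (by simp) _).hasFDerivAt
  · exact hΨ.contDiffAt

/-- A choice of ambient coordinates adapted to a regular level set. -/
def IsRegularLevelSet.ambientChart {F : E → G} {S : Set E} (h : IsRegularLevelSet F S) (x : S) :
    OpenPartialHomeomorph E (G × LevelModel E G) :=
  (h.exists_ambientChart x).choose

theorem IsRegularLevelSet.mem_ambientChart_source {F : E → G} {S : Set E}
    (h : IsRegularLevelSet F S) (x : S) : (x : E) ∈ (h.ambientChart x).source :=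
  (h.exists_ambientChart x).choose_spec.1

theorem IsRegularLevelSet.contDiffOn_ambientChart {F : E → G} {S : Set E}
    (h : IsRegularLevelSet F S) (x : S) :
    ContDiffOn ℝ ∞ (h.ambientChart x) (h.ambientChart x).source :=
  (h.exists_ambientChart x).choose_spec.2.2.1

theorem IsRegularLevelSet.contDiffOn_ambientChart_symm {F : E → G} {S : Set E}
    (h : IsRegularLevelSet F S) (x : S) :
    ContDiffOn ℝ ∞ (h.ambientChart x).symm (h.ambientChart x).target :=
  (h.exists_ambientChart x).choose_spec.2.2.2

theorem IsRegularLevelSet.ambientChart_fst {F : E → G} {S : Set E} (h : IsRegularLevelSet F S)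
    (x y : S) (hy : (y : E) ∈ (h.ambientChart x).source) : (h.ambientChart x y).1 = 0 := by
  have h1 : (h.ambientChart x y).1 = F y := (h.exists_ambientChart x).choose_spec.2.1 y hy
  rw [h1]
  exact (h.mem_iff y).1 y.2

theorem IsRegularLevelSet.ambientChart_symm_mem {F : E → G} {S : Set E}
    (h : IsRegularLevelSet F S) (x : S) (v : LevelModel E G)
    (hv : ((0 : G), v) ∈ (h.ambientChart x).target) : (h.ambientChart x).symm (0, v) ∈ S := by
  have h1 := (h.exists_ambientChart x).choose_spec.2.1 _ ((h.ambientChart x).map_target hv)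
  rw [h.mem_iff, ← h1]
  exact congrArg Prod.fst ((h.ambientChart x).right_inv hv)

open Classical in
/-- The inverse of the chart of a regular level set (with the junk value `x` off the target). -/
def IsRegularLevelSet.chartInv {F : E → G} {S : Set E} (h : IsRegularLevelSet F S) (x : S)
    (v : LevelModel E G) : S :=
  if hv : (h.ambientChart x).symm (0, v) ∈ S then ⟨(h.ambientChart x).symm (0, v), hv⟩ else x

theorem IsRegularLevelSet.coe_chartInv {F : E → G} {S : Set E} (h : IsRegularLevelSet F S) (x : S)
    (v : LevelModel E G) (hv : ((0 : G), v) ∈ (h.ambientChart x).target) :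
    (h.chartInv x v : E) = (h.ambientChart x).symm (0, v) := by
  simp only [IsRegularLevelSet.chartInv, h.ambientChart_symm_mem x v hv, dite_true]

/-- The chart of a regular level set around `x`: the second component of ambient coordinates
adapted to the level set. -/
def IsRegularLevelSet.chart {F : E → G} {S : Set E} (h : IsRegularLevelSet F S) (x : S) :
    OpenPartialHomeomorph S (LevelModel E G) where
  toFun y := (h.ambientChart x y).2
  invFun := h.chartInv x
  source := {y | (y : E) ∈ (h.ambientChart x).source}
  target := {v | ((0 : G), v) ∈ (h.ambientChart x).target}
  map_source' y hy := by
    change ((0 : G), (h.ambientChart x y).2) ∈ (h.ambientChart x).target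
    rw [← h.ambientChart_fst x y hy]
    exact (h.ambientChart x).map_source hy
  map_target' v hv := by
    change (h.chartInv x v : E) ∈ (h.ambientChart x).source
    rw [h.coe_chartInv x v hv]
    exact (h.ambientChart x).map_target hv
  left_inv' y hy := by
    have h1 : ((0 : G), (h.ambientChart x y).2) = h.ambientChart x y :=
      Prod.ext (h.ambientChart_fst x y hy).symm rfl
    refine Subtype.ext ?_
    rw [h.coe_chartInv, h1]
    · exact (h.ambientChart x).left_inv hy
    · rw [h1]
      exact (h.ambientChart x).map_source hy
  right_inv' v hv := by
    rw [h.coe_chartInv x v hv, (h.ambientChart x).right_inv hv]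
  open_source := (h.ambientChart x).open_source.preimage continuous_subtype_val
  open_target := (h.ambientChart x).open_target.preimage (by fun_prop)
  continuousOn_toFun := by
    refine continuous_snd.comp_continuousOn ?_
    exact (h.ambientChart x).continuousOn.comp continuous_subtype_val.continuousOn fun y hy => hy
  continuousOn_invFun := by
    rw [Topology.IsInducing.subtypeVal.continuousOn_iff]
    have hc : ContinuousOn (fun v : LevelModel E G => (h.ambientChart x).symm (0, v))
        {v | ((0 : G), v) ∈ (h.ambientChart x).target} :=
      (h.ambientChart x).continuousOn_symm.comp (by fun_prop) fun v hv => hv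
    exact hc.congr fun v hv => h.coe_chartInv x v hv

/-- The atlas of a regular level set. -/
@[reducible]
def IsRegularLevelSet.chartedSpace {F : E → G} {S : Set E} (h : IsRegularLevelSet F S) :
    ChartedSpace (LevelModel E G) S where
  atlas := range h.chart
  chartAt := h.chart
  mem_chart_source x := h.mem_ambientChart_source x
  chart_mem_atlas x := mem_range_self x

theorem IsRegularLevelSet.isManifold {F : E → G} {S : Set E} (h : IsRegularLevelSet F S) :
    @IsManifold ℝ _ (LevelModel E G) _ _ (LevelModel E G) _ 𝓘(ℝ, LevelModel E G) ∞ S _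
      h.chartedSpace := by
  let _ := h.chartedSpace
  refine isManifold_of_contDiffOn _ _ _ ?_
  rintro _ _ ⟨x, rfl⟩ ⟨y, rfl⟩
  have hc : ContDiffOn ℝ ∞
      (fun v : LevelModel E G => (h.ambientChart y ((h.ambientChart x).symm (0, v))).2)
      {v | ((0 : G), v) ∈ (h.ambientChart x).target ∧
        (h.ambientChart x).symm (0, v) ∈ (h.ambientChart y).source} :=
    contDiff_snd.comp_contDiffOn ((h.contDiffOn_ambientChart y).comp
      ((h.contDiffOn_ambientChart_symm x).comp (by fun_prop) fun v hv => hv.1) fun v hv => hv.2)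
  have hset : ∀ v ∈ ((h.chart x).symm.trans (h.chart y)).source,
      ((0 : G), v) ∈ (h.ambientChart x).target ∧
        (h.ambientChart x).symm (0, v) ∈ (h.ambientChart y).source := by
    rintro v ⟨hv1, hv2⟩
    refine ⟨hv1, ?_⟩
    rw [← h.coe_chartInv x v hv1]
    exact hv2
  refine (hc.mono (fun v hv => hset v (by simpa using hv))).congr fun v hv => ?_
  have hv' := hset v (by simpa using hv)
  change (h.ambientChart y (h.chartInv x v : E)).2 = _
  rw [h.coe_chartInv x v hv'.1]

end LevelSet

/-! ### Differential forms, cotangent bundles and symplectic forms -/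

section Forms

variable {E : Type*} [NormedAddCommGroup E] [NormedSpace ℝ E]
  {H : Type*} [TopologicalSpace H] (I : ModelWithCorners ℝ E H) [I.Boundaryless]
  {M : Type*} [TopologicalSpace M] [ChartedSpace H M]
  {E' : Type*} [NormedAddCommGroup E'] [NormedSpace ℝ E']
  {H' : Type*} [TopologicalSpace H'] (I' : ModelWithCorners ℝ E' H') [I'.Boundaryless]
  {M' : Type*} [TopologicalSpace M'] [ChartedSpace H' M']

/-- (Not necessarily smooth) differential `k`-forms on a manifold without boundary. -/
abbrev MForm (M : Type*) [TopologicalSpace M] [ChartedSpace H M] (k : ℕ) : Type _ :=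
  ∀ x : M, TangentSpace I x [⋀^Fin k]→L[ℝ] ℝ

variable {I}

/-- The representative of `σ` in the preferred chart at `x`, that is, the pullback of `σ` by the
inverse of this chart. -/
def MForm.inChart {k : ℕ} (σ : MForm I M k) (x : M) (y : E) : E [⋀^Fin k]→L[ℝ] ℝ :=
  (σ ((extChartAt I x).symm y)).compContinuousLinearMap
    (mfderiv 𝓘(ℝ, E) I (extChartAt I x).symm y)

/-- Smoothness of a differential form: all its chart representatives are smooth. -/
def MForm.IsSmooth {k : ℕ} (σ : MForm I M k) : Prop :=
  ∀ x : M, ContDiffOn ℝ ∞ (σ.inChart x) (extChartAt I x).target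

/-- The exterior derivative of a differential form, computed at `x` in the preferred chart
at `x`. -/
def MForm.d {k : ℕ} (σ : MForm I M k) : MForm I M (k + 1) := fun x =>
  (extDeriv (σ.inChart x) (extChartAt I x x)).compContinuousLinearMap
    (mfderiv I 𝓘(ℝ, E) (extChartAt I x) x)

variable {I'} in
/-- The pullback of a differential form. -/
def MForm.pullback {k : ℕ} (f : M → M') (σ : MForm I' M' k) : MForm I M k := fun x =>
  (σ (f x)).compContinuousLinearMap (mfderiv I I' f x)

/-- A symplectic form: a smooth, closed and nondegenerate `2`-form. -/
structure MForm.IsSymplectic (σ : MForm I M 2) : Prop where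
  smooth : σ.IsSmooth
  closed : ∀ x, σ.d x = 0
  nondegenerate : ∀ (x : M) (v : TangentSpace I x), (∀ w, σ x ![v, w] = 0) → v = 0

variable {I'} in
/-- `f : (M, σ) → (M', η)` is a symplectomorphism: `σ` and `η` are symplectic forms, `f` is a
smooth diffeomorphism, and `f` pulls `η` back to `σ`. -/
structure IsSymplectomorphism (f : M → M') (σ : MForm I M 2) (η : MForm I' M' 2) : Prop where
  symplectic_source : σ.IsSymplectic
  symplectic_target : η.IsSymplectic
  diffeomorph : ∃ Φ : M ≃ₘ^∞⟮I, I'⟯ M', ⇑Φ = f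
  pullback_eq : MForm.pullback (I := I) f η = σ

variable (I)

/-- The total space of the cotangent bundle. -/
abbrev CotangentBundle (M : Type*) [TopologicalSpace M] [ChartedSpace H M] [IsManifold I ∞ M] :
    Type _ :=
  TotalSpace (E →L[ℝ] ℝ) (fun x : M => TangentSpace I x →L[ℝ] Bundle.Trivial M ℝ x)

/-- The tautological one-form `θ` on the cotangent bundle, `θ_p(X) = p(π_* X)`. -/
def tautologicalForm (M : Type*) [TopologicalSpace M] [ChartedSpace H M] [IsManifold I ∞ M] :
    MForm (I.prod 𝓘(ℝ, E →L[ℝ] ℝ)) (CotangentBundle I M) 1 := fun p =>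
  ContinuousAlternatingMap.ofSubsingleton ℝ (TangentSpace (I.prod 𝓘(ℝ, E →L[ℝ] ℝ)) p) ℝ (0 : Fin 1)
    ((p.snd : TangentSpace I p.proj →L[ℝ] ℝ).comp
      (mfderiv (I.prod 𝓘(ℝ, E →L[ℝ] ℝ)) I (fun q : CotangentBundle I M => q.proj) p))

/-- The canonical two-form `ω_c = -dθ` on the cotangent bundle. -/
def canonicalForm (M : Type*) [TopologicalSpace M] [ChartedSpace H M] [IsManifold I ∞ M] :
    MForm (I.prod 𝓘(ℝ, E →L[ℝ] ℝ)) (CotangentBundle I M) 2 :=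
  -(tautologicalForm I M).d

end Forms

/-! ### The Stiefel manifold and the manifold `W⁰` -/

/-- Real `n × N` matrices, as a normed space (the norm is only used through its topology and
smooth structure). -/
abbrev RMat (n N : ℕ) : Type := Fin n → Fin N → ℝ

/-- An element of `RMat n N` viewed as a matrix, so that matrix operations apply to it. -/
abbrev mat {n N : ℕ} (A : RMat n N) : Matrix (Fin n) (Fin N) ℝ := Matrix.of A

/-- A matrix viewed as an element of `RMat n N`. -/
abbrev unmat {n N : ℕ} (A : Matrix (Fin n) (Fin N) ℝ) : RMat n N := Matrix.of.symm A

/-- The pairing `⟨A, B⟩ = Tr(Aᵀ B)`. -/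
def trPair {n N : ℕ} (A B : RMat n N) : ℝ := trace ((mat A)ᵀ * mat B)

/-- The Stiefel manifold `V(n, N) = {Q | Q Qᵀ = I}`. -/
def Stiefel (n N : ℕ) : Set (RMat n N) := {Q | mat Q * (mat Q)ᵀ = 1}

/-- The solution space `W⁰_{n,N} = {(Q, P) | Q Qᵀ = I, Q Pᵀ + P Qᵀ = 0}`. -/
def WZero (n N : ℕ) : Set (RMat n N × RMat n N) :=
  {x | mat x.1 * (mat x.1)ᵀ = 1 ∧ mat x.1 * (mat x.2)ᵀ + mat x.2 * (mat x.1)ᵀ = 0}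

/-- Symmetric real `n × n` matrices. -/
def SymMat (n : ℕ) : Submodule ℝ (RMat n n) where
  carrier := {A | (mat A)ᵀ = mat A}
  add_mem' {A B} hA hB := by
    have h : mat (A + B) = mat A + mat B := rfl
    simp only [mem_ofPred_eq] at *
    rw [h, transpose_add, hA, hB]
  zero_mem' := transpose_zero
  smul_mem' c A hA := by
    have h : mat (c • A) = c • mat A := rfl
    simp only [mem_ofPred_eq] at *
    rw [h, transpose_smul, hA]

/-- The map `A ↦ A + Aᵀ` from matrices to symmetric matrices. -/
def symPart (n : ℕ) : RMat n n →L[ℝ] SymMat n :=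
  LinearMap.toContinuousLinearMap
    { toFun := fun A => ⟨unmat (mat A + (mat A)ᵀ), by
        change (mat A + (mat A)ᵀ)ᵀ = mat A + (mat A)ᵀ
        rw [transpose_add, transpose_transpose, add_comm]⟩
      map_add' := fun A B => Subtype.ext (by
        change mat A + mat B + (mat A + mat B)ᵀ = mat A + (mat A)ᵀ + (mat B + (mat B)ᵀ)
        rw [transpose_add]; abel)
      map_smul' := fun c A => Subtype.ext (by
        change c • mat A + (c • mat A)ᵀ = c • (mat A + (mat A)ᵀ)
        rw [transpose_smul, smul_add]) }

theorem mat_symPart {n : ℕ} (A : RMat n n) : mat (symPart n A : RMat n n) = mat A + (mat A)ᵀ := rfl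

theorem symPart_eq_zero_iff {n : ℕ} (A : RMat n n) : symPart n A = 0 ↔ mat A + (mat A)ᵀ = 0 :=
  Subtype.ext_iff

/-- The defining function of `V(n, N)`, with values in the symmetric matrices. -/
def stiefelFun (n N : ℕ) (Q : RMat n N) : SymMat n := symPart n (unmat (mat Q * (mat Q)ᵀ - 1))

/-- The defining function of `W⁰_{n,N}`, with values in pairs of symmetric matrices. -/
def wZeroFun (n N : ℕ) (x : RMat n N × RMat n N) : SymMat n × SymMat n :=
  (stiefelFun n N x.1, symPart n (unmat (mat x.1 * (mat x.2)ᵀ)))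

theorem contDiff_mul_transpose {n N : ℕ} {X : Type*} [NormedAddCommGroup X] [NormedSpace ℝ X]
    {f g : X → RMat n N} (hf : ContDiff ℝ ∞ f) (hg : ContDiff ℝ ∞ g) :
    ContDiff ℝ ∞ (fun x => unmat (mat (f x) * (mat (g x))ᵀ)) := by
  refine contDiff_pi.2 fun i => contDiff_pi.2 fun j => ?_
  have h : (fun x => unmat (mat (f x) * (mat (g x))ᵀ) i j) =
      fun x => ∑ k, f x i k * g x j k := rfl
  rw [h]
  refine ContDiff.sum fun k _ => ContDiff.mul ?_ ?_
  · exact contDiff_pi.1 (contDiff_pi.1 hf i) k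
  · exact contDiff_pi.1 (contDiff_pi.1 hg j) k

theorem contDiff_stiefelFun (n N : ℕ) : ContDiff ℝ ∞ (stiefelFun n N) :=
  (symPart n).contDiff.comp
    ((contDiff_mul_transpose contDiff_id contDiff_id).sub (contDiff_const (c := unmat 1)))

theorem contDiff_wZeroFun (n N : ℕ) : ContDiff ℝ ∞ (wZeroFun n N) :=
  ((contDiff_stiefelFun n N).comp contDiff_fst).prodMk
    ((symPart n).contDiff.comp (contDiff_mul_transpose contDiff_fst contDiff_snd))

/-- The derivative in the direction `v` of a map that is quadratic along the line `x + ℝ v`. -/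
theorem fderiv_eq_of_quadratic {X Y : Type*} [NormedAddCommGroup X] [NormedSpace ℝ X]
    [NormedAddCommGroup Y] [NormedSpace ℝ Y] {F : X → Y} {x v : X} (hF : DifferentiableAt ℝ F x)
    (a b : Y) (h : ∀ t : ℝ, F (x + t • v) = F x + t • a + t ^ 2 • b) : fderiv ℝ F x v = a := by
  have h1 : HasDerivAt (fun t : ℝ => F (x + t • v)) (fderiv ℝ F x v) 0 :=
    hF.hasFDerivAt.hasLineDerivAt v
  have h2 : HasDerivAt (fun t : ℝ => F x + t • a + t ^ 2 • b) a 0 := by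
    have h3 := (((hasDerivAt_id (0 : ℝ)).smul_const a).const_add (F x)).add
      (((hasDerivAt_id (0 : ℝ)).pow 2).smul_const b)
    refine (h3.congr_deriv ?_).congr_of_eventuallyEq (Filter.Eventually.of_forall fun t => ?_)
    · simp
    · simp
  rw [← funext h] at h2
  exact h1.unique h2

theorem stiefelFun_line {n N : ℕ} (Q X : RMat n N) (t : ℝ) :
    stiefelFun n N (Q + t • X) = stiefelFun n N Q +
      t • (2 : ℝ) • symPart n (unmat (mat Q * (mat X)ᵀ)) +
      t ^ 2 • symPart n (unmat (mat X * (mat X)ᵀ)) := by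
  refine Subtype.ext ?_
  change ((mat Q + t • mat X) * (mat Q + t • mat X)ᵀ - 1) +
      ((mat Q + t • mat X) * (mat Q + t • mat X)ᵀ - 1)ᵀ =
    (mat Q * (mat Q)ᵀ - 1) + (mat Q * (mat Q)ᵀ - 1)ᵀ +
      t • (2 : ℝ) • (mat Q * (mat X)ᵀ + (mat Q * (mat X)ᵀ)ᵀ) +
      t ^ 2 • (mat X * (mat X)ᵀ + (mat X * (mat X)ᵀ)ᵀ)
  simp only [transpose_add, transpose_smul, transpose_sub, transpose_mul, transpose_transpose,
    transpose_one, Matrix.add_mul, Matrix.mul_add, Matrix.smul_mul, Matrix.mul_smul, smul_add,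
    smul_smul]
  module

theorem fderiv_stiefelFun {n N : ℕ} (Q X : RMat n N) : fderiv ℝ (stiefelFun n N) Q X =
    (2 : ℝ) • symPart n (unmat (mat Q * (mat X)ᵀ)) :=
  fderiv_eq_of_quadratic ((contDiff_stiefelFun n N).differentiable (by simp) Q) _ _
    (stiefelFun_line Q X)

theorem fderiv_wZeroFun {n N : ℕ} (x v : RMat n N × RMat n N) : fderiv ℝ (wZeroFun n N) x v =
    ((2 : ℝ) • symPart n (unmat (mat x.1 * (mat v.1)ᵀ)),
      symPart n (unmat (mat x.1 * (mat v.2)ᵀ + mat v.1 * (mat x.2)ᵀ))) := by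
  refine fderiv_eq_of_quadratic ((contDiff_wZeroFun n N).differentiable (by simp) x) _
    (symPart n (unmat (mat v.1 * (mat v.1)ᵀ)), symPart n (unmat (mat v.1 * (mat v.2)ᵀ)))
    fun t => Prod.ext (stiefelFun_line x.1 v.1 t) ?_
  change symPart n (unmat ((mat x.1 + t • mat v.1) * (mat x.2 + t • mat v.2)ᵀ)) =
    symPart n (unmat (mat x.1 * (mat x.2)ᵀ)) +
      t • symPart n (unmat (mat x.1 * (mat v.2)ᵀ + mat v.1 * (mat x.2)ᵀ)) +
      t ^ 2 • symPart n (unmat (mat v.1 * (mat v.2)ᵀ))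
  rw [← (symPart n).map_smul, ← (symPart n).map_smul, ← (symPart n).map_add,
    ← (symPart n).map_add]
  congr 1
  change (mat x.1 + t • mat v.1) * (mat x.2 + t • mat v.2)ᵀ = mat x.1 * (mat x.2)ᵀ +
      t • (mat x.1 * (mat v.2)ᵀ + mat v.1 * (mat x.2)ᵀ) + t ^ 2 • (mat v.1 * (mat v.2)ᵀ)
  simp only [transpose_add, transpose_smul, Matrix.add_mul, Matrix.mul_add, Matrix.smul_mul,
    Matrix.mul_smul, smul_add, smul_smul]
  module

theorem mem_stiefel_iff {n N : ℕ} (Q : RMat n N) : Q ∈ Stiefel n N ↔ stiefelFun n N Q = 0 := by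
  rw [stiefelFun, symPart_eq_zero_iff]
  change mat Q * (mat Q)ᵀ = 1 ↔ mat Q * (mat Q)ᵀ - 1 + (mat Q * (mat Q)ᵀ - 1)ᵀ = 0
  have h : (mat Q * (mat Q)ᵀ - 1)ᵀ = mat Q * (mat Q)ᵀ - 1 := by
    rw [transpose_sub, transpose_mul, transpose_transpose, transpose_one]
  rw [h, ← two_smul ℝ, smul_eq_zero_iff_right two_ne_zero, sub_eq_zero]

/-- `X = ½ A Q` solves `Q Xᵀ + X Qᵀ = A`. -/
theorem symPart_solve {n N : ℕ} {Q : RMat n N} (hQ : Q ∈ Stiefel n N) (A : SymMat n) :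
    symPart n (unmat (mat Q * (mat (unmat ((1 / 2 : ℝ) • (mat (A : RMat n n) * mat Q))))ᵀ)) = A := by
  have hA : (mat (A : RMat n n))ᵀ = mat (A : RMat n n) := A.2
  have hQ' : mat Q * (mat Q)ᵀ = 1 := hQ
  refine Subtype.ext ?_
  change mat Q * ((1 / 2 : ℝ) • (mat (A : RMat n n) * mat Q))ᵀ +
    (mat Q * ((1 / 2 : ℝ) • (mat (A : RMat n n) * mat Q))ᵀ)ᵀ = mat (A : RMat n n)
  rw [transpose_smul, transpose_mul, hA, Matrix.mul_smul, ← Matrix.mul_assoc, hQ', Matrix.one_mul,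
    transpose_smul, hA]
  module

theorem isRegularLevelSet_stiefel (n N : ℕ) :
    IsRegularLevelSet (stiefelFun n N) (Stiefel n N) where
  smooth := contDiff_stiefelFun n N
  mem_iff := mem_stiefel_iff
  surj Q hQ A := by
    refine ⟨unmat ((1 / 2 : ℝ) •
      (mat (((1 / 2 : ℝ) • A : SymMat n) : RMat n n) * mat Q)), ?_⟩
    rw [fderiv_stiefelFun, symPart_solve hQ, smul_smul]
    norm_num

theorem isRegularLevelSet_wZero (n N : ℕ) :
    IsRegularLevelSet (wZeroFun n N) (WZero n N) where
  smooth := contDiff_wZeroFun n N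
  mem_iff x := by
    have h : (mat x.1 * (mat x.2)ᵀ)ᵀ = mat x.2 * (mat x.1)ᵀ := by
      rw [transpose_mul, transpose_transpose]
    have h2 : symPart n (unmat (mat x.1 * (mat x.2)ᵀ)) = 0 ↔
        mat x.1 * (mat x.2)ᵀ + mat x.2 * (mat x.1)ᵀ = 0 := by
      rw [symPart_eq_zero_iff, ← h]
      rfl
    rw [wZeroFun, Prod.mk_eq_zero, ← mem_stiefel_iff, h2]
    rfl
  surj x hx A := by
    let X : RMat n N := unmat ((1 / 2 : ℝ) •
      (mat (((1 / 2 : ℝ) • A.1 : SymMat n) : RMat n n) * mat x.1))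
    let B : SymMat n := A.2 - symPart n (unmat (mat X * (mat x.2)ᵀ))
    refine ⟨(X, unmat ((1 / 2 : ℝ) • (mat (B : RMat n n) * mat x.1))), ?_⟩
    rw [fderiv_wZeroFun]
    refine Prod.ext ?_ ?_
    · change (2 : ℝ) • symPart n (unmat (mat x.1 * (mat X)ᵀ)) = A.1
      rw [symPart_solve hx.1, smul_smul]
      norm_num
    · change symPart n (unmat (mat x.1 *
        (mat (unmat ((1 / 2 : ℝ) • (mat (B : RMat n n) * mat x.1))))ᵀ) +
          unmat (mat X * (mat x.2)ᵀ)) = A.2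
      rw [map_add, symPart_solve hx.1]
      exact sub_add_cancel _ _

/-- The model space of `V(n, N)`. -/
abbrev StiefelModel (n N : ℕ) : Type := LevelModel (RMat n N) (SymMat n)

/-- The model space of `W⁰_{n,N}`. -/
abbrev WZeroModel (n N : ℕ) : Type := LevelModel (RMat n N × RMat n N) (SymMat n × SymMat n)

/-- `V(n, N)` as a submanifold of the space of matrices. -/
instance Stiefel.instChartedSpace (n N : ℕ) : ChartedSpace (StiefelModel n N) (Stiefel n N) :=
  (isRegularLevelSet_stiefel n N).chartedSpace

instance Stiefel.instIsManifold (n N : ℕ) :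
    IsManifold 𝓘(ℝ, StiefelModel n N) ∞ (Stiefel n N) :=
  (isRegularLevelSet_stiefel n N).isManifold

/-- `W⁰_{n,N}` as a submanifold of the space of pairs of matrices. -/
instance WZero.instChartedSpace (n N : ℕ) : ChartedSpace (WZeroModel n N) (WZero n N) :=
  (isRegularLevelSet_wZero n N).chartedSpace

instance WZero.instIsManifold (n N : ℕ) :
    IsManifold 𝓘(ℝ, WZeroModel n N) ∞ (WZero n N) :=
  (isRegularLevelSet_wZero n N).isManifold

theorem trPair_comm {n N : ℕ} (A B : RMat n N) : trPair A B = trPair B A := by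
  rw [trPair, trPair, ← trace_transpose ((mat A)ᵀ * mat B), transpose_mul, transpose_transpose]

theorem trPair_add_right {n N : ℕ} (A B C : RMat n N) :
    trPair A (B + C) = trPair A B + trPair A C := by
  have h : mat (B + C) = mat B + mat C := rfl
  rw [trPair, h, Matrix.mul_add, trace_add, trPair, trPair]

theorem trPair_smul_right {n N : ℕ} (c : ℝ) (A B : RMat n N) :
    trPair A (c • B) = c * trPair A B := by
  have h : mat (c • B) = c • mat B := rfl
  rw [trPair, h, Matrix.mul_smul, trace_smul, trPair, smul_eq_mul]

theorem continuous_trPair {n N : ℕ} :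
    Continuous (fun x : RMat n N × RMat n N => trPair x.1 x.2) := by
  have h : (fun x : RMat n N × RMat n N => trPair x.1 x.2) =
      fun x => ∑ j, ∑ i, x.1 i j * x.2 i j := rfl
  rw [h]
  fun_prop

/-- The symplectic form `ω((A₁, A₂), (B₁, B₂)) = ⟨A₁, B₂⟩ - ⟨A₂, B₁⟩` on pairs of matrices. -/
def ambientForm (n N : ℕ) : (RMat n N × RMat n N) [⋀^Fin 2]→L[ℝ] ℝ where
  toFun v := trPair (v 0).1 (v 1).2 - trPair (v 0).2 (v 1).1
  map_update_add' := by
    intro _ v i A B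
    fin_cases i <;> simp [trPair_add_right, trPair_comm _ (v 1).1, trPair_comm _ (v 1).2] <;> ring
  map_update_smul' := by
    intro _ v i c A
    fin_cases i <;> simp [trPair_smul_right, trPair_comm _ (v 1).1, trPair_comm _ (v 1).2] <;> ring
  cont := by
    refine Continuous.sub (continuous_trPair.comp (f := fun v : Fin 2 → RMat n N × RMat n N =>
      ((v 0).1, (v 1).2)) (by fun_prop)) (continuous_trPair.comp
      (f := fun v : Fin 2 → RMat n N × RMat n N => ((v 0).2, (v 1).1)) (by fun_prop))
  map_eq_zero_of_eq' := by
    intro v i j hij hne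
    have h01 : v 0 = v 1 := by
      fin_cases i <;> fin_cases j <;> simp_all
    change trPair (v 0).1 (v 1).2 - trPair (v 0).2 (v 1).1 = 0
    rw [h01, trPair_comm, sub_self]

/-- The two-form `Ω` on `W⁰_{n,N}`: the restriction of the ambient symplectic form, that is, its
pullback by the inclusion. -/
def wZeroForm (n N : ℕ) : MForm 𝓘(ℝ, WZeroModel n N) (WZero n N) 2 := fun x =>
  (ambientForm n N).compContinuousLinearMap
    (mfderiv 𝓘(ℝ, WZeroModel n N) 𝓘(ℝ, RMat n N × RMat n N)
      (Subtype.val : WZero n N → RMat n N × RMat n N) x)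

/-- The linear form `⟨S, ·⟩` on matrices. -/
def trPairL {n N : ℕ} (S : RMat n N) : RMat n N →L[ℝ] ℝ :=
  LinearMap.toContinuousLinearMap
    { toFun := fun X => trPair S X
      map_add' := trPair_add_right S
      map_smul' := fun c X => trPair_smul_right c S X }

/-- The cotangent bundle `T*V(n, N)` of the Stiefel manifold. -/
abbrev StiefelCotangent (n N : ℕ) : Type :=
  CotangentBundle 𝓘(ℝ, StiefelModel n N) (Stiefel n N)

/-- The point `(Q, S)` of `T*V(n, N)`: the covector `⟨S, ·⟩` on the tangent space `T_Q V(n, N)`,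
where tangent vectors are viewed as matrices. -/
def stiefelCovector {n N : ℕ} (Q : Stiefel n N) (S : RMat n N) : StiefelCotangent n N :=
  ⟨Q, (trPairL S).comp (mfderiv 𝓘(ℝ, StiefelModel n N) 𝓘(ℝ, RMat n N)
    (Subtype.val : Stiefel n N → RMat n N) Q)⟩

/-- `M̄ = -½ Qᵀ (P Qᵀ - Q Pᵀ) Q + Qᵀ P - Pᵀ Q`. -/
def mBar {n N : ℕ} (Q P : Matrix (Fin n) (Fin N) ℝ) : Matrix (Fin N) (Fin N) ℝ :=
  -((1 / 2 : ℝ) • (Qᵀ * (P * Qᵀ - Q * Pᵀ) * Q)) + Qᵀ * P - Pᵀ * Q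

/-- The map `Φ : W⁰_{n,N} → T*V(n, N)`, `(Q, P₀) ↦ (Q, Q M̄)`. -/
def phiMap (n N : ℕ) (x : WZero n N) : StiefelCotangent n N :=
  stiefelCovector ⟨x.1.1, x.2.1⟩ (unmat (mat x.1.1 * mBar (mat x.1.1) (mat x.1.2)))

end

/-!
On `W⁰` the relation `Q P₀ᵀ + P₀ Qᵀ = 0` gives `Q M̄ = P₀` (`mul_mBar`), so `Φ(Q, P₀)` is the
covector `⟨P₀, ·⟩` at `Q`. The same relation says that `P₀` is tangent to the Stiefel manifold `V`
at `Q`, hence `W⁰` is the tangent bundle of `V` in matrix form and `Φ` is its identification with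
the cotangent bundle by the metric `⟨·, ·⟩`. The inverse `phiInv` represents a covector `α` at `Q` by a
tangent matrix: evaluate `α` on the orthogonal projections to `T_Q V` of the elementary matrices and
project the resulting matrix to `T_Q V`.

Smoothness of `Φ` and `phiInv` is checked in the ambient matrix spaces. A map into a regular level
set is smooth when it is smooth into the ambient space (`IsRegularLevelSet.contMDiffAt_of_val`), a
family of tangent vectors is smooth when the corresponding ambient vectors are
(`IsRegularLevelSet.contMDiffAt_tangent`), and the tangent spaces are the kernels of the derivative
of the defining function (`IsRegularLevelSet.exists_mfderiv_val_eq_iff`).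

For the forms, `Φ` pulls the tautological form back to the restriction of `⟨P, dQ⟩`
(`pullback_tautologicalForm`), whose exterior derivative is `-Ω` because the exterior derivative
commutes with pullbacks (`MForm.d_pullback`). As `Φ` is a diffeomorphism, the canonical form is
symplectic because `Ω` is (`MForm.isSymplectomorphism_of_pullback_oneForm`). The form `Ω` is closed
as the restriction of a constant form, and its nondegeneracy is linear algebra
(`isSymplectic_wZeroForm`).
-/

/-! ### Smoothness of the pullback of alternating forms -/

section Alternating

variable {ι E F G X : Type*} [Fintype ι] [DecidableEq ι] [NormedAddCommGroup E] [NormedSpace ℝ E]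
  [NormedAddCommGroup F] [NormedSpace ℝ F] [NormedAddCommGroup G] [NormedSpace ℝ G]
  [NormedAddCommGroup X] [NormedSpace ℝ X]

/-- Alternatization of continuous multilinear maps, as a continuous linear map. -/
noncomputable def ContinuousMultilinearMap.alternatizationL :
    ContinuousMultilinearMap ℝ (fun _ : ι => E) G →L[ℝ] E [⋀^ι]→L[ℝ] G :=
  LinearMap.mkContinuous
    { toFun := fun f => f.alternatization
      map_add' := map_add _
      map_smul' := fun c f => by
        ext v
        simp [ContinuousMultilinearMap.alternatization_apply_apply, Finset.smul_sum, smul_comm c] }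
    (Fintype.card (Equiv.Perm ι)) fun f => by
      refine ContinuousAlternatingMap.opNorm_le_bound _ (by positivity) fun v => ?_
      simp only [LinearMap.coe_mk, AddHom.coe_mk,
        ContinuousMultilinearMap.alternatization_apply_apply]
      refine (norm_sum_le _ _).trans ?_
      rw [mul_assoc, ← nsmul_eq_mul]
      refine Finset.sum_le_card_nsmul _ _ _ fun σ _ => ?_
      have h1 : ‖Equiv.Perm.sign σ • f (v ∘ σ)‖ = ‖f (v ∘ σ)‖ := by
        rcases Int.units_eq_one_or (Equiv.Perm.sign σ) with h | h <;> simp [h]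
      rw [h1]
      refine (f.le_opNorm _).trans_eq ?_
      simp only [Function.comp_apply]
      rw [Equiv.prod_comp σ fun i => ‖v i‖]

theorem ContinuousMultilinearMap.alternatizationL_coe (f : E [⋀^ι]→L[ℝ] G) :
    ContinuousMultilinearMap.alternatizationL f.toContinuousMultilinearMap =
      (Fintype.card ι).factorial • f := by
  ext v
  have h := congrArg (fun a => a v) (AlternatingMap.coe_alternatization f.toAlternatingMap)
  simp only [MultilinearMap.alternatization_apply] at h
  change f.toContinuousMultilinearMap.alternatization v = _
  rw [ContinuousMultilinearMap.alternatization_apply_apply]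
  exact h

/-- The pullback of an alternating map is smooth in the map and in the linear map along which it is
pulled back. This is known for multilinear maps, and alternatization carries it over: up to the
factor `k!` it is a left inverse of the inclusion of alternating maps into multilinear maps. -/
theorem ContinuousAlternatingMap.contDiff_compContinuousLinearMap {n : WithTop ℕ∞} :
    ContDiff ℝ n (fun p : (F [⋀^ι]→L[ℝ] G) × (E →L[ℝ] F) => p.1.compContinuousLinearMap p.2) := by
  have h1 : ContDiff ℝ n (fun p : (F [⋀^ι]→L[ℝ] G) × (E →L[ℝ] F) =>
      ContinuousMultilinearMap.compContinuousLinearMapContinuousMultilinear ℝ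
        (fun _ : ι => E) (fun _ => F) G (fun _ => p.2)
        (ContinuousAlternatingMap.toContinuousMultilinearMapCLM ℝ p.1)) := by
    refine ContDiff.clm_apply ?_ ?_
    · exact (ContinuousMultilinearMap.contDiff _).comp (contDiff_pi.2 fun _ => contDiff_snd)
    · exact (ContinuousLinearMap.contDiff _).comp contDiff_fst
  have h2 := (((Fintype.card ι).factorial : ℝ)⁻¹ •
    (ContinuousMultilinearMap.alternatizationL (ι := ι) (E := E) (G := G))).contDiff.comp h1
  convert h2 using 2 with p
  have h3 := ContinuousMultilinearMap.alternatizationL_coe (p.1.compContinuousLinearMap p.2)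
  have h4 : ((Fintype.card ι).factorial : ℝ) ≠ 0 := by positivity
  rw [← Nat.cast_smul_eq_nsmul ℝ] at h3
  exact ((inv_smul_eq_iff₀ h4).2 h3).symm

theorem ContDiffAt.compContinuousLinearMap {n : WithTop ℕ∞} {f : X → F [⋀^ι]→L[ℝ] G}
    {g : X → E →L[ℝ] F} {x : X} (hf : ContDiffAt ℝ n f x) (hg : ContDiffAt ℝ n g x) :
    ContDiffAt ℝ n (fun y => (f y).compContinuousLinearMap (g y)) x :=
  ContinuousAlternatingMap.contDiff_compContinuousLinearMap.contDiffAt.comp x (hf.prodMk hg)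

end Alternating

/-! ### Pullbacks of differential forms -/

section Forms

variable {E : Type*} [NormedAddCommGroup E] [NormedSpace ℝ E]
  {H : Type*} [TopologicalSpace H] {I : ModelWithCorners ℝ E H}
  {M : Type*} [TopologicalSpace M] [ChartedSpace H M]
  {E' : Type*} [NormedAddCommGroup E'] [NormedSpace ℝ E']
  {H' : Type*} [TopologicalSpace H'] {I' : ModelWithCorners ℝ E' H'}
  {M' : Type*} [TopologicalSpace M'] [ChartedSpace H' M']
  {E'' : Type*} [NormedAddCommGroup E''] [NormedSpace ℝ E'']
  {H'' : Type*} [TopologicalSpace H''] {I'' : ModelWithCorners ℝ E'' H''}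
  {M'' : Type*} [TopologicalSpace M''] [ChartedSpace H'' M'']

theorem contMDiffAt_extChartAt_symm [I.Boundaryless] [IsManifold I ∞ M] (x : M) {y : E}
    (hy : y ∈ (extChartAt I x).target) : ContMDiffAt 𝓘(ℝ, E) I ∞ (extChartAt I x).symm y :=
  (contMDiffOn_extChartAt_symm x y hy).contMDiffAt ((isOpen_extChartAt_target x).mem_nhds hy)

theorem contMDiffAt_extChartAt_of_mem [IsManifold I ∞ M] (x : M) {y : M}
    (hy : y ∈ (extChartAt I x).source) : ContMDiffAt I 𝓘(ℝ, E) ∞ (extChartAt I x) y :=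
  contMDiffAt_extChartAt' (by rwa [extChartAt_source] at hy)

theorem ContMDiffAt.mdiffAt {f : M → M'} {x : M} (h : ContMDiffAt I I' ∞ f x) :
    MDifferentiableAt I I' f x :=
  h.mdifferentiableAt (by simp)

namespace MForm

theorem pullback_comp {k : ℕ} (σ : MForm I'' M'' k) {f : M → M'} {g : M' → M''}
    (hf : ContMDiff I I' ∞ f) (hg : ContMDiff I' I'' ∞ g) :
    pullback (I := I) (g ∘ f) σ = pullback (I := I) f (pullback (I := I') g σ) := by
  funext x
  change (σ (g (f x))).compContinuousLinearMap (mfderiv I I'' (g ∘ f) x) = _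
  rw [mfderiv_comp x (hg _).mdiffAt (hf x).mdiffAt]
  rfl

theorem pullback_id {k : ℕ} (σ : MForm I M k) : pullback (I := I) id σ = σ := by
  funext x
  change (σ x).compContinuousLinearMap (mfderiv I I id x) = _
  rw [mfderiv_id]
  rfl

theorem pullback_neg {k : ℕ} (f : M → M') (σ : MForm I' M' k) :
    pullback (I := I) f (-σ) = -pullback (I := I) f σ := rfl

variable [I.Boundaryless] [I'.Boundaryless]

/-- In charts, the pullback by `f` is the pullback by the coordinate expression of `f`. The chart
of `M` need not be centred at the point under consideration, which is what smoothness on the whole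
chart target requires. -/
theorem inChart_pullback [IsManifold I ∞ M] [IsManifold I' ∞ M'] {k : ℕ} (σ : MForm I' M' k)
    {f : M → M'} (hf : ContMDiff I I' ∞ f) (x : M) {y₀ : E} (hy₀ : y₀ ∈ (extChartAt I x).target)
    (z : M') (hz : f ((extChartAt I x).symm y₀) ∈ (extChartAt I' z).source) :
    (pullback (I := I) f σ).inChart x =ᶠ[nhds y₀] fun y =>
      (σ.inChart z ((extChartAt I' z ∘ f ∘ (extChartAt I x).symm) y)).compContinuousLinearMap
        (fderiv ℝ (extChartAt I' z ∘ f ∘ (extChartAt I x).symm) y) := by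
  have hc : ContinuousAt (f ∘ (extChartAt I x).symm) y₀ :=
    ((hf _).comp y₀ (contMDiffAt_extChartAt_symm x hy₀)).continuousAt
  filter_upwards [(isOpen_extChartAt_target (I := I) x).mem_nhds hy₀,
    hc.preimage_mem_nhds ((isOpen_extChartAt_source (I := I') z).mem_nhds hz)] with y hy hyz
  have hyz' : f ((extChartAt I x).symm y) ∈ (extChartAt I' z).source := hyz
  have h1 : ContMDiffAt 𝓘(ℝ, E) I' ∞ (f ∘ (extChartAt I x).symm) y :=
    (hf _).comp y (contMDiffAt_extChartAt_symm x hy)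
  have h2 := contMDiffAt_extChartAt_of_mem (I := I') z hyz'
  have hl : (extChartAt I' z).symm (extChartAt I' z (f ((extChartAt I x).symm y))) =
    f ((extChartAt I x).symm y) := (extChartAt I' z).left_inv hyz'
  have h3 : ContMDiffAt 𝓘(ℝ, E') I' ∞ (extChartAt I' z).symm
      ((extChartAt I' z ∘ f ∘ (extChartAt I x).symm) y) :=
    contMDiffAt_extChartAt_symm z ((extChartAt I' z).map_source hyz')
  -- near `y`, the coordinate expression of `f` followed by the inverse chart is `f` itself
  have h4 : mfderiv 𝓘(ℝ, E) I' (f ∘ (extChartAt I x).symm) y =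
      (mfderiv 𝓘(ℝ, E') I' (extChartAt I' z).symm
        ((extChartAt I' z ∘ f ∘ (extChartAt I x).symm) y)).comp
      (mfderiv 𝓘(ℝ, E) 𝓘(ℝ, E') (extChartAt I' z ∘ f ∘ (extChartAt I x).symm) y) := by
    rw [← mfderiv_comp y h3.mdiffAt (h2.comp y h1).mdiffAt]
    refine Filter.EventuallyEq.mfderiv_eq ?_
    filter_upwards [h1.continuousAt.preimage_mem_nhds
      ((isOpen_extChartAt_source (I := I') z).mem_nhds hyz')] with w hw
    exact ((extChartAt I' z).left_inv hw).symm
  rw [mfderiv_comp y (hf _).mdiffAt (contMDiffAt_extChartAt_symm x hy).mdiffAt,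
    mfderiv_eq_fderiv] at h4
  ext v
  have h5 : ∀ (p q : M') (h : p = q) (A : E →L[ℝ] E'),
      (σ p : E' [⋀^Fin k]→L[ℝ] ℝ).compContinuousLinearMap A =
      (σ q : E' [⋀^Fin k]→L[ℝ] ℝ).compContinuousLinearMap A := by
    rintro p _ rfl A; rfl
  exact congrArg (fun a : E [⋀^Fin k]→L[ℝ] ℝ => a v) ((h5 _ _ hl.symm _).trans
    (congrArg (fun A : E →L[ℝ] E' =>
      (σ ((extChartAt I' z).symm (extChartAt I' z (f ((extChartAt I x).symm y)))) :
        E' [⋀^Fin k]→L[ℝ] ℝ).compContinuousLinearMap A) h4))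

theorem IsSmooth.pullback [IsManifold I ∞ M] [IsManifold I' ∞ M'] {k : ℕ} {σ : MForm I' M' k}
    (hσ : σ.IsSmooth) {f : M → M'} (hf : ContMDiff I I' ∞ f) :
    (MForm.pullback (I := I) f σ).IsSmooth := by
  intro x y hy
  set z := f ((extChartAt I x).symm y) with hz
  have hzs : z ∈ (extChartAt I' z).source := mem_extChartAt_source z
  refine ContDiffAt.contDiffWithinAt ?_
  refine ContDiffAt.congr_of_eventuallyEq ?_ (inChart_pullback σ hf x hy z hzs)
  have hg : ContDiffAt ℝ ∞ (extChartAt I' z ∘ f ∘ (extChartAt I x).symm) y :=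
    ((contMDiffAt_extChartAt_of_mem (I := I') z hzs).comp y
      ((hf _).comp y (contMDiffAt_extChartAt_symm x hy))).contDiffAt
  have hm : (extChartAt I' z ∘ f ∘ (extChartAt I x).symm) y ∈ (extChartAt I' z).target :=
    (extChartAt I' z).map_source hzs
  exact (((hσ z).contDiffAt ((isOpen_extChartAt_target z).mem_nhds hm)).comp y hg
    ).compContinuousLinearMap (hg.fderiv_right (by simp))

/-- The exterior derivative commutes with pullbacks. -/
theorem d_pullback [IsManifold I ∞ M] [IsManifold I' ∞ M'] {k : ℕ} {σ : MForm I' M' k}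
    (hσ : σ.IsSmooth) {f : M → M'} (hf : ContMDiff I I' ∞ f) :
    (MForm.pullback (I := I) f σ).d = MForm.pullback (I := I) f σ.d := by
  funext x
  have hy := mem_extChartAt_target (I := I) x
  have hl := (extChartAt I x).left_inv (mem_extChartAt_source (I := I) x)
  have hzs : f ((extChartAt I x).symm (extChartAt I x x)) ∈ (extChartAt I' (f x)).source := by
    rw [hl]; exact mem_extChartAt_source _
  have hg0 : (extChartAt I' (f x) ∘ f ∘ (extChartAt I x).symm) (extChartAt I x x) =
      extChartAt I' (f x) (f x) := by
    simp only [Function.comp_apply, hl]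
  have hg : ContDiffAt ℝ ∞ (extChartAt I' (f x) ∘ f ∘ (extChartAt I x).symm)
      (extChartAt I x x) :=
    ((contMDiffAt_extChartAt_of_mem (I := I') (f x) hzs).comp (extChartAt I x x)
      ((hf _).comp (extChartAt I x x) (contMDiffAt_extChartAt_symm x hy))).contDiffAt
  have hω : DifferentiableAt ℝ (σ.inChart (f x))
      ((extChartAt I' (f x) ∘ f ∘ (extChartAt I x).symm) (extChartAt I x x)) := by
    rw [hg0]
    exact ((hσ (f x)).contDiffAt ((isOpen_extChartAt_target (f x)).mem_nhds
      (mem_extChartAt_target _))).differentiableAt (by simp)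
  change (extDeriv ((MForm.pullback (I := I) f σ).inChart x) (extChartAt I x x)
    ).compContinuousLinearMap (mfderiv I 𝓘(ℝ, E) (extChartAt I x) x) = _
  rw [(inChart_pullback σ hf x hy (f x) hzs).extDeriv_eq,
    extDeriv_pullback hω hg (by
      rw [minSmoothness_of_isRCLikeNormedField]
      exact WithTop.coe_le_coe.2 (le_top : (2 : ℕ∞) ≤ ⊤)), hg0]
  have h1 := contMDiffAt_extChartAt_of_mem x (mem_extChartAt_source (I := I) x)
  have h2 := contMDiffAt_extChartAt_of_mem (f x) (mem_extChartAt_source (I := I') (f x))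
  have h4 : (mfderiv 𝓘(ℝ, E) 𝓘(ℝ, E') (extChartAt I' (f x) ∘ f ∘ (extChartAt I x).symm)
        (extChartAt I x x)).comp (mfderiv I 𝓘(ℝ, E) (extChartAt I x) x) =
      (mfderiv I' 𝓘(ℝ, E') (extChartAt I' (f x)) (f x)).comp (mfderiv I I' f x) := by
    rw [← mfderiv_comp x hg.contMDiffAt.mdiffAt h1.mdiffAt, ← mfderiv_comp x h2.mdiffAt
      (hf x).mdiffAt]
    refine Filter.EventuallyEq.mfderiv_eq ?_
    filter_upwards [(isOpen_extChartAt_source (I := I) x).mem_nhds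
      (mem_extChartAt_source x)] with w hw
    simp only [Function.comp_apply, (extChartAt I x).left_inv hw]
  rw [mfderiv_eq_fderiv] at h4
  exact congrArg (fun A : TangentSpace I x →L[ℝ] E' =>
    (extDeriv (σ.inChart (f x)) (extChartAt I' (f x) (f x))).compContinuousLinearMap A) h4

theorem inChart_modelSpace {k : ℕ} (σ : E → E [⋀^Fin k]→L[ℝ] ℝ) (x : E) :
    MForm.inChart (I := 𝓘(ℝ, E)) (M := E) σ x = σ := by
  funext y
  have h : mfderiv 𝓘(ℝ, E) 𝓘(ℝ, E) (extChartAt 𝓘(ℝ, E) x).symm y = ContinuousLinearMap.id ℝ E := by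
    rw [mfderiv_eq_fderiv]
    exact fderiv_id
  exact congrArg (σ y).compContinuousLinearMap h

theorem isSmooth_of_contDiff {k : ℕ} {σ : E → E [⋀^Fin k]→L[ℝ] ℝ} (hσ : ContDiff ℝ ∞ σ) :
    MForm.IsSmooth (I := 𝓘(ℝ, E)) (M := E) σ := by
  intro x
  rw [inChart_modelSpace]
  exact hσ.contDiffOn

theorem d_eq_extDeriv {k : ℕ} (σ : E → E [⋀^Fin k]→L[ℝ] ℝ) :
    MForm.d (I := 𝓘(ℝ, E)) (M := E) σ = extDeriv σ := by
  funext x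
  have h : mfderiv 𝓘(ℝ, E) 𝓘(ℝ, E) (extChartAt 𝓘(ℝ, E) x) x = ContinuousLinearMap.id ℝ E := by
    rw [mfderiv_eq_fderiv]
    exact fderiv_id
  change (extDeriv (MForm.inChart (I := 𝓘(ℝ, E)) (M := E) σ x) x).compContinuousLinearMap _ = _
  rw [inChart_modelSpace]
  exact congrArg (extDeriv σ x).compContinuousLinearMap h

theorem IsSymplectic.pullback_diffeomorph [IsManifold I ∞ M] [IsManifold I' ∞ M']
    {σ : MForm I' M' 2} (hσ : σ.IsSymplectic) (Φ : M ≃ₘ^∞⟮I, I'⟯ M') :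
    (MForm.pullback (I := I) Φ σ).IsSymplectic where
  smooth := hσ.smooth.pullback Φ.contMDiff
  closed x := by
    rw [d_pullback hσ.smooth Φ.contMDiff]
    change (σ.d (Φ x)).compContinuousLinearMap _ = _
    rw [hσ.closed]
    rfl
  nondegenerate x v hv := by
    let e := Φ.mfderivToContinuousLinearEquiv (by simp) x
    have he : ∀ w, e w = mfderiv I I' Φ x w := fun w => rfl
    have h : e v = 0 := by
      refine hσ.nondegenerate (Φ x) _ fun w => ?_
      have h1 := hv (e.symm w)
      change σ (Φ x) (fun i => mfderiv I I' Φ x (![v, e.symm w] i)) = 0 at h1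
      convert h1 using 2
      funext i
      fin_cases i
      · rfl
      · exact (e.apply_symm_apply w).symm
    exact (map_eq_zero_iff e e.injective).1 h

/-- A diffeomorphism that pulls a one-form `θ` back to a smooth form with exterior derivative `-Ω`,
where `Ω` is symplectic, is a symplectomorphism from `Ω` to `-dθ`. Smoothness of `θ` need not be
assumed: `θ` is the pullback of a smooth form by the inverse diffeomorphism. -/
theorem isSymplectomorphism_of_pullback_oneForm [IsManifold I ∞ M] [IsManifold I' ∞ M']
    (Φ : M ≃ₘ^∞⟮I, I'⟯ M') {θ : MForm I' M' 1} {Ω : MForm I M 2}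
    (hθ : (MForm.pullback (I := I) Φ θ).IsSmooth) (hΩ : Ω.IsSymplectic)
    (hd : (MForm.pullback (I := I) Φ θ).d = -Ω) : IsSymplectomorphism Φ Ω (-θ.d) := by
  -- a form on `M'` is the pullback by `Φ⁻¹` of its pullback by `Φ`
  have hΦ : ∀ {k : ℕ} (σ : MForm I' M' k),
      MForm.pullback (I := I') Φ.symm (MForm.pullback (I := I) Φ σ) = σ := by
    intro k σ
    rw [← pullback_comp σ Φ.symm.contMDiff Φ.contMDiff,
      funext (f := Φ ∘ Φ.symm) (g := id) Φ.apply_symm_apply, pullback_id]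
  have hθ' : θ.IsSmooth := by
    rw [← hΦ θ]
    exact hθ.pullback Φ.symm.contMDiff
  have hpull : MForm.pullback (I := I) Φ (-θ.d) = Ω := by
    rw [pullback_neg, ← d_pullback hθ' Φ.contMDiff, hd, neg_neg]
  refine ⟨hΩ, ?_, ⟨Φ, rfl⟩, hpull⟩
  rw [← hΦ (-θ.d), hpull]
  exact hΩ.pullback_diffeomorph Φ.symm

end MForm

end Forms

/-! ### Calculus on regular level sets -/

section LevelSet

variable {E G : Type*} [NormedAddCommGroup E] [NormedSpace ℝ E] [FiniteDimensional ℝ E]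
  [NormedAddCommGroup G] [NormedSpace ℝ G] [FiniteDimensional ℝ G]
  {E' : Type*} [NormedAddCommGroup E'] [NormedSpace ℝ E']
  {H' : Type*} [TopologicalSpace H'] {I' : ModelWithCorners ℝ E' H'}
  {M : Type*} [TopologicalSpace M] [ChartedSpace H' M]

namespace IsRegularLevelSet

variable {F : E → G} {S : Set E} (h : IsRegularLevelSet F S)

include h

theorem contMDiff_val : letI := h.chartedSpace
    ContMDiff 𝓘(ℝ, LevelModel E G) 𝓘(ℝ, E) ∞ (Subtype.val : S → E) := by
  let _ := h.chartedSpace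
  intro x
  rw [contMDiffAt_iff]
  refine ⟨continuous_subtype_val.continuousAt, ContDiffAt.contDiffWithinAt ?_⟩
  have ht : IsOpen {v : LevelModel E G | ((0 : G), v) ∈ (h.ambientChart x).target} :=
    (h.ambientChart x).open_target.preimage (by fun_prop)
  have hx : ((0 : G), (h.ambientChart x x).2) ∈ (h.ambientChart x).target :=
    (h.chart x).map_source (h.mem_ambientChart_source x)
  have h1 : ContDiffAt ℝ ∞ (fun v : LevelModel E G => (h.ambientChart x).symm (0, v))
      (h.ambientChart x x).2 :=
    ((h.contDiffOn_ambientChart_symm x).contDiffAt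
      ((h.ambientChart x).open_target.mem_nhds hx)).comp (h.ambientChart x x).2 (by fun_prop)
  refine h1.congr_of_eventuallyEq ?_
  filter_upwards [ht.mem_nhds hx] with v hv
  exact h.coe_chartInv x v hv

theorem contDiffOn_ambientChart_snd (x : S) :
    ContDiffOn ℝ ∞ (fun e => (h.ambientChart x e).2) (h.ambientChart x).source :=
  contDiff_snd.comp_contDiffOn (h.contDiffOn_ambientChart x)

theorem contDiffAt_ambientChart_snd (x : S) {e : E} (he : e ∈ (h.ambientChart x).source) :
    ContDiffAt ℝ ∞ (fun e => (h.ambientChart x e).2) e :=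
  (h.contDiffOn_ambientChart_snd x).contDiffAt ((h.ambientChart x).open_source.mem_nhds he)

/-- A map into a regular level set is smooth as soon as it is smooth as a map into the ambient
space. -/
theorem contMDiffAt_of_val {f : M → S} {x : M}
    (hf : ContMDiffAt I' 𝓘(ℝ, E) ∞ (fun m => (f m : E)) x) : letI := h.chartedSpace
    ContMDiffAt I' 𝓘(ℝ, LevelModel E G) ∞ f x := by
  let _ := h.chartedSpace
  rw [contMDiffAt_iff_target]
  refine ⟨Topology.IsInducing.subtypeVal.continuousAt_iff.2 hf.continuousAt, ?_⟩
  exact ContMDiffAt.comp (g := fun e => (h.ambientChart (f x) e).2) (f := fun m => (f m : E)) x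
    (h.contDiffAt_ambientChart_snd (f x) (h.mem_ambientChart_source _)).contMDiffAt hf

/-- The preferred chart of a level set is the restriction of a smooth map on the ambient space. -/
theorem mfderiv_extChartAt_eq (x y : S) (hy : (y : E) ∈ (h.ambientChart x).source) :
    letI := h.chartedSpace
    mfderiv 𝓘(ℝ, LevelModel E G) 𝓘(ℝ, LevelModel E G) (extChartAt 𝓘(ℝ, LevelModel E G) x) y =
      (fderiv ℝ (fun e => (h.ambientChart x e).2) y).comp
        (mfderiv 𝓘(ℝ, LevelModel E G) 𝓘(ℝ, E) (Subtype.val : S → E) y) := by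
  let _ := h.chartedSpace
  have h1 := (h.contDiffAt_ambientChart_snd x hy).contMDiffAt.mdiffAt
  have h2 := mfderiv_comp y h1 (h.contMDiff_val y).mdiffAt
  rw [mfderiv_eq_fderiv] at h2
  exact h2

theorem injective_mfderiv_val (x : S) : letI := h.chartedSpace
    Function.Injective (mfderiv 𝓘(ℝ, LevelModel E G) 𝓘(ℝ, E) (Subtype.val : S → E) x) := by
  let _ := h.chartedSpace
  have := h.isManifold
  have h1 := h.mfderiv_extChartAt_eq x x (h.mem_ambientChart_source x)
  have h2 : (mfderiv 𝓘(ℝ, LevelModel E G) 𝓘(ℝ, LevelModel E G)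
      (extChartAt 𝓘(ℝ, LevelModel E G) x) x).IsInvertible :=
    isInvertible_mfderiv_extChartAt (mem_extChartAt_source x)
  have h3 := h2.injective
  rw [h1] at h3
  exact Function.Injective.of_comp h3

theorem fderiv_mfderiv_val (x : S) (v : LevelModel E G) : letI := h.chartedSpace
    fderiv ℝ F x (mfderiv 𝓘(ℝ, LevelModel E G) 𝓘(ℝ, E) (Subtype.val : S → E) x v) = 0 := by
  let _ := h.chartedSpace
  have h1 : MDifferentiableAt 𝓘(ℝ, E) 𝓘(ℝ, G) F x := h.smooth.contDiffAt.contMDiffAt.mdiffAt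
  have h2 := mfderiv_comp x h1 (h.contMDiff_val x).mdiffAt
  have h3 : F ∘ (Subtype.val : S → E) = fun _ => 0 := by
    funext y
    exact (h.mem_iff y).1 y.2
  rw [h3, mfderiv_const, mfderiv_eq_fderiv] at h2
  exact (congrArg (fun A : LevelModel E G →L[ℝ] G => A v) h2).symm

/-- The tangent space of a regular level set is the kernel of the derivative of the defining
function. -/
theorem exists_mfderiv_val_eq_iff (x : S) (w : E) : letI := h.chartedSpace
    (∃ v : LevelModel E G,
      mfderiv 𝓘(ℝ, LevelModel E G) 𝓘(ℝ, E) (Subtype.val : S → E) x v = w) ↔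
    fderiv ℝ F x w = 0 := by
  let _ := h.chartedSpace
  let A : LevelModel E G →L[ℝ] E :=
    mfderiv 𝓘(ℝ, LevelModel E G) 𝓘(ℝ, E) (Subtype.val : S → E) x
  let B : E →ₗ[ℝ] G := (fderiv ℝ F x).toLinearMap
  have hle : LinearMap.range A.toLinearMap ≤ LinearMap.ker B := by
    rintro _ ⟨v, rfl⟩
    exact h.fderiv_mfderiv_val x v
  have h1 : Module.finrank ℝ (LinearMap.range A.toLinearMap) =
      Module.finrank ℝ E - Module.finrank ℝ G := by
    rw [LinearMap.finrank_range_of_inj (f := A.toLinearMap) (h.injective_mfderiv_val x)]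
    simp
  have h2 := LinearMap.finrank_range_add_finrank_ker B
  rw [LinearMap.range_eq_top.2 (h.surj x x.2), finrank_top] at h2
  -- the range and the kernel both have dimension `dim E - dim G`
  have heq := Submodule.eq_of_le_of_finrank_eq hle (by omega)
  exact (SetLike.ext_iff.1 heq w)

/-- A family of tangent vectors of a regular level set is smooth as soon as its base points and
the corresponding ambient vectors depend smoothly on the parameter. -/
theorem contMDiffAt_tangent {b : M → S} {v : M → LevelModel E G} {w : M → E} {x : M}
    (hb : letI := h.chartedSpace; ContMDiffAt I' 𝓘(ℝ, LevelModel E G) ∞ b x)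
    (hw : ContMDiffAt I' 𝓘(ℝ, E) ∞ w x)
    (hv : letI := h.chartedSpace
      ∀ m, mfderiv 𝓘(ℝ, LevelModel E G) 𝓘(ℝ, E) (Subtype.val : S → E) (b m) (v m) = w m) :
    letI := h.chartedSpace
    haveI := h.isManifold
    ContMDiffAt I' (𝓘(ℝ, LevelModel E G).prod 𝓘(ℝ, LevelModel E G)) ∞
      (fun m => (TotalSpace.mk' (LevelModel E G) (b m) (v m) :
        TangentBundle 𝓘(ℝ, LevelModel E G) S)) x := by
  let _ := h.chartedSpace
  have := h.isManifold
  rw [contMDiffAt_totalSpace]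
  refine ⟨hb, ?_⟩
  have hbs : (b x : E) ∈ (h.ambientChart (b x)).source := h.mem_ambientChart_source _
  have hvb := (h.contMDiff_val (b x)).comp x hb
  have h1 : ContMDiffAt I' 𝓘(ℝ, LevelModel E G) ∞
      (fun m => fderiv ℝ (fun e => (h.ambientChart (b x) e).2) (b m) (w m)) x :=
    ((((h.contDiffAt_ambientChart_snd (b x) hbs).fderiv_right (m := ∞)
      (by simp)).contMDiffAt).comp x hvb).clm_apply hw
  refine h1.congr_of_eventuallyEq ?_
  filter_upwards [hvb.continuousAt.preimage_mem_nhds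
    ((h.ambientChart (b x)).open_source.mem_nhds hbs)] with m hm
  have hm' : b m ∈ (chartAt (LevelModel E G) (b x)).source := hm
  have h2 : ∀ u : TangentSpace 𝓘(ℝ, LevelModel E G) (b m),
      (trivializationAt (LevelModel E G) (TangentSpace 𝓘(ℝ, LevelModel E G)) (b x)
        (TotalSpace.mk' (LevelModel E G) (b m) u)).2 =
      (trivializationAt (LevelModel E G) (TangentSpace 𝓘(ℝ, LevelModel E G))
        (b x)).continuousLinearMapAt ℝ (b m) u := by
    intro u
    rw [Trivialization.continuousLinearMapAt_apply, Trivialization.linearMapAt_apply,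
      if_pos (by simpa using hm')]
  refine (h2 _).trans ?_
  rw [TangentBundle.continuousLinearMapAt_trivializationAt hm', h.mfderiv_extChartAt_eq _ _ hm,
    ← hv m]
  rfl

end IsRegularLevelSet

end LevelSet

/-! ### Linear algebra on the tangent spaces -/

section TangentSpaces

variable {n N : ℕ}

theorem trPair_eq_sum (A B : RMat n N) : trPair A B = ∑ i, ∑ j, A i j * B i j := by
  rw [Finset.sum_comm]
  rfl

theorem trPair_add_left (A B C : RMat n N) : trPair (A + B) C = trPair A C + trPair B C := by
  rw [trPair_comm, trPair_add_right, trPair_comm C, trPair_comm C]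

theorem trPair_smul_left (c : ℝ) (A B : RMat n N) : trPair (c • A) B = c * trPair A B := by
  rw [trPair_comm, trPair_smul_right, trPair_comm]

theorem trPair_zero_right (A : RMat n N) : trPair A 0 = 0 := by
  rw [← zero_smul ℝ (0 : RMat n N), trPair_smul_right, zero_mul]

theorem trPair_zero_left (A : RMat n N) : trPair 0 A = 0 := by
  rw [trPair_comm, trPair_zero_right]

theorem trPair_sub_left (A B C : RMat n N) : trPair (A - B) C = trPair A C - trPair B C := by
  rw [sub_eq_add_neg, ← neg_one_smul ℝ B, trPair_add_left, trPair_smul_left]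
  ring

theorem eq_zero_of_trPair_self {A : RMat n N} (h : trPair A A = 0) : A = 0 := by
  rw [trPair_eq_sum, Finset.sum_eq_zero_iff_of_nonneg
    (fun i _ => Finset.sum_nonneg fun j _ => mul_self_nonneg _)] at h
  funext i j
  have h1 := (Finset.sum_eq_zero_iff_of_nonneg (fun j _ => mul_self_nonneg (A i j))).1
    (h i (Finset.mem_univ i)) j (Finset.mem_univ j)
  exact mul_self_eq_zero.1 h1

/-- The linear map `S ↦ ⟨S, ·⟩`. -/
noncomputable def trPairCLM (n N : ℕ) : RMat n N →L[ℝ] RMat n N →L[ℝ] ℝ :=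
  LinearMap.toContinuousLinearMap
    { toFun := trPairL
      map_add' := fun A B => ContinuousLinearMap.ext (trPair_add_left A B)
      map_smul' := fun c A => ContinuousLinearMap.ext (trPair_smul_left c A) }

/-- `X` is tangent at `Q` to the Stiefel manifold, as a condition on matrices. -/
def IsStiefelTangent (Q X : RMat n N) : Prop := mat Q * (mat X)ᵀ + mat X * (mat Q)ᵀ = 0

theorem IsStiefelTangent.sub {Q X Y : RMat n N} (hX : IsStiefelTangent Q X)
    (hY : IsStiefelTangent Q Y) : IsStiefelTangent Q (X - Y) := by
  have h : mat (X - Y) = mat X - mat Y := rfl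
  rw [IsStiefelTangent, h, transpose_sub, Matrix.mul_sub, Matrix.sub_mul, sub_add_sub_comm,
    hX, hY, sub_zero]

/-- For `Q` in the Stiefel manifold, the orthogonal projection onto the tangent space at `Q`. -/
noncomputable def stiefelProj (Q X : RMat n N) : RMat n N :=
  X - unmat ((1 / 2 : ℝ) • ((mat X * (mat Q)ᵀ + mat Q * (mat X)ᵀ) * mat Q))

theorem isStiefelTangent_stiefelProj {Q : RMat n N} (hQ : Q ∈ Stiefel n N) (X : RMat n N) :
    IsStiefelTangent Q (stiefelProj Q X) := by
  have hQ' : mat Q * (mat Q)ᵀ = 1 := hQ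
  have h : mat (stiefelProj Q X) =
    mat X - (1 / 2 : ℝ) • ((mat X * (mat Q)ᵀ + mat Q * (mat X)ᵀ) * mat Q) := rfl
  rw [IsStiefelTangent, h, transpose_sub, transpose_smul, transpose_mul, transpose_add,
    transpose_mul, transpose_mul, transpose_transpose, transpose_transpose, Matrix.mul_sub,
    Matrix.sub_mul, Matrix.mul_smul, Matrix.smul_mul, Matrix.mul_assoc _ (mat Q) (mat Q)ᵀ,
    ← Matrix.mul_assoc (mat Q) (mat Q)ᵀ, hQ', Matrix.mul_one, Matrix.one_mul]
  module

/-- The matrices `S Q` with `S` symmetric are normal to the Stiefel manifold at `Q`. -/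
theorem trPair_mul_eq_zero {Q Z : RMat n N} (hZ : IsStiefelTangent Q Z)
    {S : Matrix (Fin n) (Fin n) ℝ} (hS : Sᵀ = S) : trPair (unmat (S * mat Q)) Z = 0 := by
  have h1 : trPair (unmat (S * mat Q)) Z = trace (S * (mat Z * (mat Q)ᵀ)) := by
    change trace ((S * mat Q)ᵀ * mat Z) = _
    rw [transpose_mul, hS, Matrix.mul_assoc, trace_mul_comm, Matrix.mul_assoc]
  have h2 : trace (S * (mat Z * (mat Q)ᵀ)) = trace (S * (mat Q * (mat Z)ᵀ)) := by
    rw [← trace_transpose, transpose_mul, hS, transpose_mul, transpose_transpose,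
      trace_mul_comm]
  have h3 : trace (S * (mat Q * (mat Z)ᵀ + mat Z * (mat Q)ᵀ)) = 0 := by
    have hZ' : mat Q * (mat Z)ᵀ + mat Z * (mat Q)ᵀ = 0 := hZ
    rw [hZ', Matrix.mul_zero, trace_zero]
  rw [Matrix.mul_add, trace_add, ← h2] at h3
  rw [h1]
  linarith

theorem trPair_stiefelProj_left {Q Z : RMat n N} (hZ : IsStiefelTangent Q Z) (X : RMat n N) :
    trPair (stiefelProj Q X) Z = trPair X Z := by
  have h : stiefelProj Q X = X -
      unmat (((1 / 2 : ℝ) • (mat X * (mat Q)ᵀ + mat Q * (mat X)ᵀ)) * mat Q) := by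
    rw [stiefelProj, Matrix.smul_mul]
  rw [h, trPair_sub_left, trPair_mul_eq_zero hZ, sub_zero]
  rw [transpose_smul, transpose_add, transpose_mul, transpose_mul, transpose_transpose,
    transpose_transpose, add_comm]

theorem stiefelProj_eq_self {Q X : RMat n N} (hX : IsStiefelTangent Q X) :
    stiefelProj Q X = X := by
  have hX' : mat Q * (mat X)ᵀ + mat X * (mat Q)ᵀ = 0 := hX
  rw [stiefelProj, add_comm, hX', Matrix.zero_mul, smul_zero]
  exact sub_zero X

theorem stiefelProj_sum_smul {ι : Type*} (s : Finset ι) (Q : RMat n N) (c : ι → ℝ)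
    (X : ι → RMat n N) :
    stiefelProj Q (∑ i ∈ s, c i • X i) = ∑ i ∈ s, c i • stiefelProj Q (X i) := by
  let L : RMat n N →ₗ[ℝ] RMat n N :=
    { toFun := stiefelProj Q
      map_add' := fun A B => by
        change mat A + mat B - (1 / 2 : ℝ) • (((mat A + mat B) * (mat Q)ᵀ +
            mat Q * (mat A + mat B)ᵀ) * mat Q) =
          (mat A - (1 / 2 : ℝ) • ((mat A * (mat Q)ᵀ + mat Q * (mat A)ᵀ) * mat Q)) +
          (mat B - (1 / 2 : ℝ) • ((mat B * (mat Q)ᵀ + mat Q * (mat B)ᵀ) * mat Q))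
        simp only [transpose_add, Matrix.add_mul, Matrix.mul_add]
        module
      map_smul' := fun c A => by
        change c • mat A - (1 / 2 : ℝ) • ((c • mat A * (mat Q)ᵀ +
            mat Q * (c • mat A)ᵀ) * mat Q) =
          c • (mat A - (1 / 2 : ℝ) • ((mat A * (mat Q)ᵀ + mat Q * (mat A)ᵀ) * mat Q))
        simp only [transpose_smul, Matrix.add_mul, Matrix.smul_mul, Matrix.mul_smul]
        module }
  change L _ = _
  rw [map_sum]
  exact Finset.sum_congr rfl fun i _ => L.map_smul _ _

theorem contDiff_stiefelProj :
    ContDiff ℝ ∞ (fun x : RMat n N × RMat n N => stiefelProj x.1 x.2) := by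
  refine contDiff_snd.sub ?_
  refine contDiff_pi.2 fun i => contDiff_pi.2 fun j => ?_
  change ContDiff ℝ ∞ (fun x : RMat n N × RMat n N =>
    (1 / 2 : ℝ) * ∑ k, (∑ l, x.2 i l * x.1 k l + ∑ l, x.1 i l * x.2 k l) * x.1 k j)
  fun_prop

/-- On `W⁰`, the matrix `Q M̄` is `P₀`. -/
theorem mul_mBar {Q P : Matrix (Fin n) (Fin N) ℝ} (hQ : Q * Qᵀ = 1) (h : Q * Pᵀ + P * Qᵀ = 0) :
    Q * mBar Q P = P := by
  have h1 : P * Qᵀ = -(Q * Pᵀ) := eq_neg_of_add_eq_zero_right h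
  rw [mBar, Matrix.mul_sub, Matrix.mul_add, Matrix.mul_neg, Matrix.mul_smul, ← Matrix.mul_assoc,
    ← Matrix.mul_assoc, ← Matrix.mul_assoc, ← Matrix.mul_assoc, hQ, Matrix.one_mul,
    Matrix.one_mul, h1, Matrix.sub_mul, Matrix.neg_mul]
  module

end TangentSpaces

/-! ### Tangent vectors and covectors of the Stiefel manifold as matrices -/

section Stiefel

variable {n N : ℕ}

theorem contMDiff_stiefel_val : ContMDiff 𝓘(ℝ, StiefelModel n N) 𝓘(ℝ, RMat n N) ∞
    (Subtype.val : Stiefel n N → RMat n N) :=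
  (isRegularLevelSet_stiefel n N).contMDiff_val

theorem contMDiff_wZero_val : ContMDiff 𝓘(ℝ, WZeroModel n N) 𝓘(ℝ, RMat n N × RMat n N) ∞
    (Subtype.val : WZero n N → RMat n N × RMat n N) :=
  (isRegularLevelSet_wZero n N).contMDiff_val

/-- The inclusion of `T_Q V(n, N)` into the space of matrices. -/
noncomputable abbrev stiefelIncl (Q : Stiefel n N) :
    TangentSpace 𝓘(ℝ, StiefelModel n N) Q →L[ℝ] RMat n N :=
  mfderiv 𝓘(ℝ, StiefelModel n N) 𝓘(ℝ, RMat n N) (Subtype.val : Stiefel n N → RMat n N) Q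

/-- The inclusion of the tangent space of `W⁰` at `x` into the space of pairs of matrices. -/
noncomputable abbrev wZeroIncl (x : WZero n N) :
    TangentSpace 𝓘(ℝ, WZeroModel n N) x →L[ℝ] RMat n N × RMat n N :=
  mfderiv 𝓘(ℝ, WZeroModel n N) 𝓘(ℝ, RMat n N × RMat n N)
    (Subtype.val : WZero n N → RMat n N × RMat n N) x

theorem exists_stiefelIncl_eq_iff (Q : Stiefel n N) (X : RMat n N) :
    (∃ v, stiefelIncl Q v = X) ↔ IsStiefelTangent Q X := by
  refine ((isRegularLevelSet_stiefel n N).exists_mfderiv_val_eq_iff Q X).trans ?_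
  rw [fderiv_stiefelFun, smul_eq_zero_iff_right two_ne_zero, symPart_eq_zero_iff]
  change mat Q.1 * (mat X)ᵀ + (mat Q.1 * (mat X)ᵀ)ᵀ = 0 ↔ _
  rw [transpose_mul, transpose_transpose]
  rfl

theorem isStiefelTangent_stiefelIncl (Q : Stiefel n N) (v : TangentSpace 𝓘(ℝ, StiefelModel n N) Q) :
    IsStiefelTangent (Q : RMat n N) (stiefelIncl Q v) :=
  (exists_stiefelIncl_eq_iff Q _).1 ⟨v, rfl⟩

theorem injective_stiefelIncl (Q : Stiefel n N) : Function.Injective (stiefelIncl Q) :=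
  (isRegularLevelSet_stiefel n N).injective_mfderiv_val Q

theorem exists_wZeroIncl_eq_iff (x : WZero n N) (X : RMat n N × RMat n N) :
    (∃ v, wZeroIncl x v = X) ↔ IsStiefelTangent x.1.1 X.1 ∧
      mat x.1.1 * (mat X.2)ᵀ + mat X.2 * (mat x.1.1)ᵀ +
        (mat X.1 * (mat x.1.2)ᵀ + mat x.1.2 * (mat X.1)ᵀ) = 0 := by
  refine ((isRegularLevelSet_wZero n N).exists_mfderiv_val_eq_iff x X).trans ?_
  rw [fderiv_wZeroFun, Prod.mk_eq_zero, smul_eq_zero_iff_right two_ne_zero, symPart_eq_zero_iff,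
    symPart_eq_zero_iff]
  change mat x.1.1 * (mat X.1)ᵀ + (mat x.1.1 * (mat X.1)ᵀ)ᵀ = 0 ∧
    mat x.1.1 * (mat X.2)ᵀ + mat X.1 * (mat x.1.2)ᵀ +
      (mat x.1.1 * (mat X.2)ᵀ + mat X.1 * (mat x.1.2)ᵀ)ᵀ = 0 ↔ _
  simp only [transpose_add, transpose_mul, transpose_transpose]
  rw [add_add_add_comm]
  rfl

theorem injective_wZeroIncl (x : WZero n N) : Function.Injective (wZeroIncl x) :=
  (isRegularLevelSet_wZero n N).injective_mfderiv_val x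

/-- The tangent vector at `Q` given by the orthogonal projection of the matrix `X`. -/
noncomputable def stiefelLift (Q : Stiefel n N) (X : RMat n N) :
    TangentSpace 𝓘(ℝ, StiefelModel n N) Q :=
  ((exists_stiefelIncl_eq_iff Q _).2 (isStiefelTangent_stiefelProj Q.2 X)).choose

theorem stiefelIncl_stiefelLift (Q : Stiefel n N) (X : RMat n N) :
    stiefelIncl Q (stiefelLift Q X) = stiefelProj Q X :=
  ((exists_stiefelIncl_eq_iff Q _).2 (isStiefelTangent_stiefelProj Q.2 X)).choose_spec

/-- The matrix whose entries are the values of a covector on the projections to `T_Q V(n, N)` of the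
elementary matrices. -/
noncomputable def covectorMatrix (p : StiefelCotangent n N) : RMat n N := fun i j =>
  (p.snd : TangentSpace 𝓘(ℝ, StiefelModel n N) p.proj →L[ℝ] ℝ)
    (stiefelLift p.proj (Pi.single i (Pi.single j 1)))

/-- The covector `p` is the restriction of `⟨covectorMatrix p, ·⟩` to the tangent space. -/
theorem trPair_covectorMatrix (p : StiefelCotangent n N)
    (v : TangentSpace 𝓘(ℝ, StiefelModel n N) p.proj) :
    trPair (covectorMatrix p) (stiefelIncl p.proj v) =
      (p.snd : TangentSpace 𝓘(ℝ, StiefelModel n N) p.proj →L[ℝ] ℝ) v := by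
  let X : RMat n N := stiefelIncl p.proj v
  let e : Fin n × Fin N → RMat n N := fun k => Pi.single k.1 (Pi.single k.2 1)
  have hX : X = ∑ k : Fin n × Fin N, X k.1 k.2 • e k := by
    funext i j
    rw [Fintype.sum_prod_type]
    simp [e, Finset.sum_apply, Pi.single_apply, Finset.sum_ite_eq, ite_apply]
  have hv : v = ∑ k : Fin n × Fin N, X k.1 k.2 • stiefelLift p.proj (e k) := by
    apply injective_stiefelIncl
    rw [map_sum]
    simp only [map_smul, stiefelIncl_stiefelLift]
    rw [← stiefelProj_sum_smul, ← hX]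
    exact (stiefelProj_eq_self (isStiefelTangent_stiefelIncl _ v)).symm
  conv_rhs => rw [hv]
  rw [map_sum, Fintype.sum_prod_type, trPair_eq_sum]
  refine Finset.sum_congr rfl fun i _ => Finset.sum_congr rfl fun j _ => ?_
  rw [map_smul, smul_eq_mul, mul_comm]
  rfl

theorem contMDiff_stiefelLift (X : RMat n N) : ContMDiff 𝓘(ℝ, StiefelModel n N)
    (𝓘(ℝ, StiefelModel n N).prod 𝓘(ℝ, StiefelModel n N)) ∞ (fun Q : Stiefel n N =>
      (TotalSpace.mk' (StiefelModel n N) Q (stiefelLift Q X) :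
        TangentBundle 𝓘(ℝ, StiefelModel n N) (Stiefel n N))) := fun Q =>
  (isRegularLevelSet_stiefel n N).contMDiffAt_tangent (b := id) (w := fun Q => stiefelProj Q X)
    contMDiffAt_id
    ((contDiff_stiefelProj.comp (contDiff_id.prodMk contDiff_const)).contMDiff.comp
      contMDiff_stiefel_val Q) (fun Q => stiefelIncl_stiefelLift Q X)

/-- The entries of `covectorMatrix` are pairings of the tautological covector with the smooth vector
fields `stiefelLift · E`, where `E` is an elementary matrix. -/
theorem contMDiff_covectorMatrix : ContMDiff
    (𝓘(ℝ, StiefelModel n N).prod 𝓘(ℝ, StiefelModel n N →L[ℝ] ℝ)) 𝓘(ℝ, RMat n N) ∞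
    (covectorMatrix : StiefelCotangent n N → RMat n N) := by
  refine contMDiff_pi_space.2 fun i => contMDiff_pi_space.2 fun j => ?_
  have h1 := (contMDiff_stiefelLift (n := n) (N := N) (Pi.single i (Pi.single j 1))).comp
    (contMDiff_proj (n := ∞) (IB := 𝓘(ℝ, StiefelModel n N)) (F := StiefelModel n N →L[ℝ] ℝ)
    (fun Q : Stiefel n N => TangentSpace 𝓘(ℝ, StiefelModel n N) Q →L[ℝ]
      Bundle.Trivial (Stiefel n N) ℝ Q))
  have h2 : ContMDiff (𝓘(ℝ, StiefelModel n N).prod 𝓘(ℝ, StiefelModel n N →L[ℝ] ℝ))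
      (𝓘(ℝ, StiefelModel n N).prod 𝓘(ℝ, StiefelModel n N →L[ℝ] ℝ)) ∞
      (fun p : StiefelCotangent n N => (TotalSpace.mk' (StiefelModel n N →L[ℝ] ℝ) p.proj p.snd :
        StiefelCotangent n N)) := contMDiff_id
  have h3 := ContMDiff.clm_bundle_apply (E₁ := fun Q : Stiefel n N =>
    TangentSpace 𝓘(ℝ, StiefelModel n N) Q) (E₂ := Bundle.Trivial (Stiefel n N) ℝ) h2 h1
  intro p
  exact (contMDiffAt_totalSpace.1 (h3 p)).2

theorem contMDiffAt_stiefelCovector {E' : Type*} [NormedAddCommGroup E'] [NormedSpace ℝ E']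
    {H' : Type*} [TopologicalSpace H'] {I' : ModelWithCorners ℝ E' H'}
    {M : Type*} [TopologicalSpace M] [ChartedSpace H' M] {q : M → Stiefel n N} {S : M → RMat n N}
    {x : M} (hq : ContMDiffAt I' 𝓘(ℝ, StiefelModel n N) ∞ q x)
    (hS : ContMDiffAt I' 𝓘(ℝ, RMat n N) ∞ S x) :
    ContMDiffAt I' (𝓘(ℝ, StiefelModel n N).prod 𝓘(ℝ, StiefelModel n N →L[ℝ] ℝ)) ∞
      (fun m => stiefelCovector (q m) (S m)) x := by
  rw [contMDiffAt_hom_bundle]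
  refine ⟨hq, ?_⟩
  have h1 : ContMDiffAt 𝓘(ℝ, StiefelModel n N) 𝓘(ℝ, StiefelModel n N →L[ℝ] RMat n N) ∞
      (inTangentCoordinates 𝓘(ℝ, StiefelModel n N) 𝓘(ℝ, RMat n N) id Subtype.val
        (fun Q : Stiefel n N => stiefelIncl Q) (q x)) (q x) :=
    (contMDiff_stiefel_val (q x)).mfderiv_const (by simp)
  have h2 : ContMDiffAt I' 𝓘(ℝ, RMat n N →L[ℝ] ℝ) ∞ (fun m => trPairL (S m)) x :=
    (trPairCLM n N).contDiff.contMDiff.contMDiffAt.comp x hS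
  refine (h2.clm_comp (h1.comp x hq)).congr_of_eventuallyEq
    (Filter.Eventually.of_forall fun m => ?_)
  have h3 : (trivializationAt (RMat n N) (TangentSpace 𝓘(ℝ, RMat n N)) (q x : RMat n N)
    ).continuousLinearMapAt ℝ (q m : RMat n N) = ContinuousLinearMap.id ℝ (RMat n N) := by
    exact TangentBundle.continuousLinearMapAt_model_space _ _
  change (Trivialization.continuousLinearMapAt ℝ
    (trivializationAt ℝ (Bundle.Trivial (Stiefel n N) ℝ) (q x)) (q m)).comp
      (((trPairL (S m)).comp (stiefelIncl (q m))).comp _) =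
    (trPairL (S m)).comp (ContinuousLinearMap.comp _ ((stiefelIncl (q m)).comp _))
  have h4 : ∀ c : ℝ, Trivialization.continuousLinearMapAt ℝ
      (trivializationAt ℝ (Bundle.Trivial (Stiefel n N) ℝ) (q x)) (q m) c = c := fun c =>
    LinearMap.congr_fun (Bundle.Trivial.linearMapAt_trivialization ℝ (Stiefel n N) ℝ (q m)) c
  rw [h3]
  ext v
  exact h4 _

end Stiefel

/-! ### The diffeomorphism -/

section Phi

variable {n N : ℕ}

/-- The base point of a point of `W⁰`. -/
def wZeroBase (x : WZero n N) : Stiefel n N := ⟨x.1.1, x.2.1⟩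

theorem contMDiff_wZero_base : ContMDiff 𝓘(ℝ, WZeroModel n N) 𝓘(ℝ, StiefelModel n N) ∞
    (wZeroBase : WZero n N → Stiefel n N) := fun x =>
  (isRegularLevelSet_stiefel n N).contMDiffAt_of_val
    ((contDiff_fst.contMDiff.comp contMDiff_wZero_val) x)

/-- On `W⁰` the map `Φ` is `(Q, P) ↦ (Q, P)`. -/
theorem phiMap_eq (x : WZero n N) :
    phiMap n N x = stiefelCovector (wZeroBase x) x.1.2 := by
  rw [phiMap, mul_mBar x.2.1 x.2.2]
  rfl

theorem contMDiff_phiMap : ContMDiff 𝓘(ℝ, WZeroModel n N)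
    (𝓘(ℝ, StiefelModel n N).prod 𝓘(ℝ, StiefelModel n N →L[ℝ] ℝ)) ∞ (phiMap n N) := by
  rw [funext phiMap_eq]
  exact fun x => contMDiffAt_stiefelCovector (contMDiff_wZero_base x)
    ((contDiff_snd.contMDiff.comp contMDiff_wZero_val) x)

/-- The inverse of `Φ`: a covector at `Q` goes to `(Q, P)`, where the tangent matrix `P` represents
the covector. -/
noncomputable def phiInv (p : StiefelCotangent n N) : WZero n N :=
  ⟨(p.proj, stiefelProj p.proj (covectorMatrix p)), p.proj.2,
    isStiefelTangent_stiefelProj p.proj.2 _⟩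

theorem contMDiff_phiInv : ContMDiff (𝓘(ℝ, StiefelModel n N).prod
    𝓘(ℝ, StiefelModel n N →L[ℝ] ℝ)) 𝓘(ℝ, WZeroModel n N) ∞
    (phiInv : StiefelCotangent n N → WZero n N) := fun p => by
  have h1 : ContMDiff (𝓘(ℝ, StiefelModel n N).prod 𝓘(ℝ, StiefelModel n N →L[ℝ] ℝ))
      𝓘(ℝ, RMat n N) ∞ (fun p : StiefelCotangent n N => (p.proj : RMat n N)) :=
    contMDiff_stiefel_val.comp (contMDiff_proj _)
  refine (isRegularLevelSet_wZero n N).contMDiffAt_of_val ?_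
  exact (h1.prodMk_space (contDiff_stiefelProj.contMDiff.comp
    (h1.prodMk_space contMDiff_covectorMatrix))) p

theorem trPair_phiInv (p : StiefelCotangent n N)
    (v : TangentSpace 𝓘(ℝ, StiefelModel n N) p.proj) :
    trPair (phiInv p).1.2 (stiefelIncl p.proj v) =
      (p.snd : TangentSpace 𝓘(ℝ, StiefelModel n N) p.proj →L[ℝ] ℝ) v :=
  (trPair_stiefelProj_left (isStiefelTangent_stiefelIncl p.proj v) _).trans
    (trPair_covectorMatrix p v)

theorem phiMap_phiInv (p : StiefelCotangent n N) : phiMap n N (phiInv p) = p := by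
  rw [phiMap_eq]
  refine TotalSpace.ext rfl (heq_of_eq ?_)
  exact ContinuousLinearMap.ext fun v => trPair_phiInv p v

theorem phiInv_phiMap (x : WZero n N) : phiInv (phiMap n N x) = x := by
  rw [phiMap_eq]
  set p := stiefelCovector (wZeroBase x) x.1.2 with hp
  have h1 : IsStiefelTangent x.1.1 ((phiInv p).1.2 - x.1.2) :=
    IsStiefelTangent.sub (Q := x.1.1) (phiInv p).2.2 x.2.2
  obtain ⟨v, hv⟩ := (exists_stiefelIncl_eq_iff (wZeroBase x) _).2 h1
  have h2 : trPair (phiInv p).1.2 (stiefelIncl (wZeroBase x) v) =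
      trPair x.1.2 (stiefelIncl (wZeroBase x) v) :=
    trPair_phiInv p v
  have h3 : (phiInv p).1.2 - x.1.2 = 0 := by
    -- the difference is tangent to the Stiefel manifold and orthogonal to all tangent vectors
    apply eq_zero_of_trPair_self
    rw [hv] at h2
    rw [trPair_sub_left, h2, sub_self]
  exact Subtype.ext (Prod.ext rfl (sub_eq_zero.1 h3))

/-- `Φ` as a diffeomorphism. -/
noncomputable def phiDiffeomorph (n N : ℕ) :
    WZero n N ≃ₘ^∞⟮𝓘(ℝ, WZeroModel n N), 𝓘(ℝ, StiefelModel n N).prod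
      𝓘(ℝ, StiefelModel n N →L[ℝ] ℝ)⟯ StiefelCotangent n N where
  toFun := phiMap n N
  invFun := phiInv
  left_inv := phiInv_phiMap
  right_inv := phiMap_phiInv
  contMDiff_toFun := contMDiff_phiMap
  contMDiff_invFun := contMDiff_phiInv

end Phi

/-! ### The symplectic forms -/

section Symplectic

/-- The one-form `λ_(Q,P)(A₁, A₂) = ⟨P, A₁⟩` on pairs of matrices. -/
noncomputable def ambientOneForm (n N : ℕ) (x : RMat n N × RMat n N) :
    (RMat n N × RMat n N) [⋀^Fin 1]→L[ℝ] ℝ :=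
  ContinuousAlternatingMap.ofSubsingleton ℝ (RMat n N × RMat n N) ℝ (0 : Fin 1)
    ((trPairL x.2).comp (ContinuousLinearMap.fst ℝ (RMat n N) (RMat n N)))

variable (n N : ℕ)

theorem contDiff_ambientOneForm : ContDiff ℝ ∞ (ambientOneForm n N) :=
  (ContinuousAlternatingMap.ofSubsingletonLIE (𝕜 := ℝ) (E := RMat n N × RMat n N) (F := ℝ)
    (ι := Fin 1) (i := 0)).toContinuousLinearEquiv.contDiff.comp
    (((trPairCLM n N).contDiff.comp contDiff_snd).clm_comp contDiff_const)

theorem extDeriv_ambientOneForm (x : RMat n N × RMat n N) :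
    extDeriv (ambientOneForm n N) x = -ambientForm n N := by
  ext v
  rw [extDeriv_apply ((contDiff_ambientOneForm n N).differentiable (by simp) x)]
  have h : ∀ c w : RMat n N × RMat n N,
      fderiv ℝ (fun y => trPair y.2 c.1) x w = trPair w.2 c.1 := by
    intro c w
    have h1 : (fun y : RMat n N × RMat n N => trPair y.2 c.1) =
        (trPairL c.1).comp (ContinuousLinearMap.snd ℝ (RMat n N) (RMat n N)) := by
      funext y
      exact trPair_comm _ _
    rw [h1, ContinuousLinearMap.fderiv]
    exact trPair_comm _ _
  rw [Fin.sum_univ_two]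
  change (-1 : ℤ) ^ 0 • fderiv ℝ (fun y : RMat n N × RMat n N => trPair y.2 (v 1).1) x (v 0) +
    (-1 : ℤ) ^ 1 • fderiv ℝ (fun y : RMat n N × RMat n N => trPair y.2 (v 0).1) x (v 1) =
      -(trPair (v 0).1 (v 1).2 - trPair (v 0).2 (v 1).1)
  rw [h, h, trPair_comm (v 0).1]
  simp
  ring

/-- The one-form on `W⁰` that corresponds to the tautological form. -/
noncomputable def wZeroOneForm : MForm 𝓘(ℝ, WZeroModel n N) (WZero n N) 1 :=
  MForm.pullback (I := 𝓘(ℝ, WZeroModel n N)) (I' := 𝓘(ℝ, RMat n N × RMat n N))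
    (Subtype.val : WZero n N → RMat n N × RMat n N) (ambientOneForm n N)

theorem wZeroForm_eq_pullback : wZeroForm n N =
    MForm.pullback (I := 𝓘(ℝ, WZeroModel n N)) (I' := 𝓘(ℝ, RMat n N × RMat n N))
      (Subtype.val : WZero n N → RMat n N × RMat n N) (fun _ => ambientForm n N) := rfl

theorem isSmooth_ambientOneForm :
    MForm.IsSmooth (I := 𝓘(ℝ, RMat n N × RMat n N)) (ambientOneForm n N) :=
  MForm.isSmooth_of_contDiff (contDiff_ambientOneForm n N)

theorem isSmooth_ambientForm :
    MForm.IsSmooth (I := 𝓘(ℝ, RMat n N × RMat n N)) (M := RMat n N × RMat n N)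
      (fun _ => ambientForm n N) :=
  MForm.isSmooth_of_contDiff contDiff_const

theorem d_wZeroOneForm : (wZeroOneForm n N).d = -wZeroForm n N := by
  rw [wZeroOneForm, MForm.d_pullback (isSmooth_ambientOneForm n N) contMDiff_wZero_val,
    MForm.d_eq_extDeriv, funext (extDeriv_ambientOneForm n N)]
  rfl

variable {n N} in
/-- The differential of `π ∘ Φ` takes `(A₁, A₂)` to `A₁`. -/
theorem mfderiv_proj_phiMap (x : WZero n N) (v : TangentSpace 𝓘(ℝ, WZeroModel n N) x) :
    stiefelIncl (phiMap n N x).proj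
      (mfderiv (𝓘(ℝ, StiefelModel n N).prod 𝓘(ℝ, StiefelModel n N →L[ℝ] ℝ))
        𝓘(ℝ, StiefelModel n N) (fun p : StiefelCotangent n N => p.proj) (phiMap n N x)
        (mfderiv 𝓘(ℝ, WZeroModel n N)
          (𝓘(ℝ, StiefelModel n N).prod 𝓘(ℝ, StiefelModel n N →L[ℝ] ℝ)) (phiMap n N) x v)) =
      (wZeroIncl x v).1 := by
  have hproj : ContMDiff (𝓘(ℝ, StiefelModel n N).prod 𝓘(ℝ, StiefelModel n N →L[ℝ] ℝ))
      𝓘(ℝ, StiefelModel n N) ∞ (fun p : StiefelCotangent n N => p.proj) := contMDiff_proj _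
  have h1 := mfderiv_comp x (hproj _).mdiffAt (contMDiff_phiMap x).mdiffAt
  have h2 := mfderiv_comp x (contMDiff_stiefel_val (phiMap n N x).proj).mdiffAt
    ((hproj _).comp x (contMDiff_phiMap x)).mdiffAt
  have h3 := mfderiv_comp x
    (ContinuousLinearMap.fst ℝ (RMat n N) (RMat n N)).contMDiff.contMDiffAt.mdiffAt
    (contMDiff_wZero_val x).mdiffAt
  rw [ContinuousLinearMap.mfderiv_eq] at h3
  rw [h1] at h2
  -- both sides are the derivative of `(Q, P) ↦ Q`
  exact DFunLike.congr_fun (h2.symm.trans h3) v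

variable {n N} in
/-- The covector `Φ(Q, P)` is `⟨P, ·⟩`. -/
theorem phiMap_snd_apply (x : WZero n N)
    (w : TangentSpace 𝓘(ℝ, StiefelModel n N) (phiMap n N x).proj) :
    ((phiMap n N x).snd : TangentSpace 𝓘(ℝ, StiefelModel n N) (phiMap n N x).proj →L[ℝ] ℝ) w =
      trPair x.1.2 (stiefelIncl (phiMap n N x).proj w) := by
  have hS : unmat (mat x.1.1 * mBar (mat x.1.1) (mat x.1.2)) = x.1.2 := mul_mBar x.2.1 x.2.2
  exact congrArg (fun P => trPair P (stiefelIncl (phiMap n N x).proj w)) hS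

/-- `Φ` pulls the tautological one-form back to the restriction of `⟨P, dQ⟩`. -/
theorem pullback_tautologicalForm : MForm.pullback (I := 𝓘(ℝ, WZeroModel n N)) (phiMap n N)
    (tautologicalForm 𝓘(ℝ, StiefelModel n N) (Stiefel n N)) = wZeroOneForm n N := by
  funext x
  ext v
  exact (phiMap_snd_apply x _).trans (congrArg (trPair x.1.2) (mfderiv_proj_phiMap x (v 0)))

/-- `Ω` is closed since it is the restriction of a constant form. If `(A₁, A₂)` is in its kernel,
pairing with `(0, A₁)` gives `A₁ = 0`; then `A₂` is tangent to the Stiefel manifold, and pairing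
with a tangent vector of `W⁰` of the form `(A₂, B)` gives `A₂ = 0`. -/
theorem isSymplectic_wZeroForm : (wZeroForm n N).IsSymplectic where
  smooth := (isSmooth_ambientForm n N).pullback contMDiff_wZero_val
  closed x := by
    rw [wZeroForm_eq_pullback, MForm.d_pullback (isSmooth_ambientForm n N) contMDiff_wZero_val,
      MForm.d_eq_extDeriv]
    have h : extDeriv (fun _ : RMat n N × RMat n N => ambientForm n N) = 0 := by
      funext y
      ext w
      rw [extDeriv_apply (differentiableAt_const _)]
      simp
    rw [h]
    rfl
  nondegenerate x v hv := by
    have h0 : ∀ B : RMat n N × RMat n N, (∃ w, wZeroIncl x w = B) →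
        trPair (wZeroIncl x v).1 B.2 - trPair (wZeroIncl x v).2 B.1 = 0 := by
      rintro _ ⟨w, rfl⟩
      exact hv w
    obtain ⟨h1, h2⟩ := (exists_wZeroIncl_eq_iff x _).1 ⟨v, rfl⟩
    set A := wZeroIncl x v with hA
    have hA1 : A.1 = 0 := by
      apply eq_zero_of_trPair_self
      have h3 := h0 (0, A.1) ((exists_wZeroIncl_eq_iff x _).2 ⟨by
        change mat x.1.1 * (0 : Matrix _ _ ℝ)ᵀ + 0 * _ = 0
        simp, by
        change mat x.1.1 * (mat A.1)ᵀ + mat A.1 * (mat x.1.1)ᵀ +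
          (0 * (mat x.1.2)ᵀ + mat x.1.2 * (0 : Matrix _ _ ℝ)ᵀ) = 0
        rw [Matrix.zero_mul, transpose_zero, Matrix.mul_zero, add_zero, add_zero]
        exact h1⟩)
      rwa [trPair_zero_right, sub_zero] at h3
    have hA2 : A.2 = 0 := by
      apply eq_zero_of_trPair_self
      have h4 : IsStiefelTangent x.1.1 A.2 := by
        rw [hA1] at h2
        change mat x.1.1 * (mat A.2)ᵀ + mat A.2 * (mat x.1.1)ᵀ +
          (0 * (mat x.1.2)ᵀ + mat x.1.2 * (0 : Matrix _ _ ℝ)ᵀ) = 0 at h2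
        rw [Matrix.zero_mul, transpose_zero, Matrix.mul_zero, add_zero, add_zero] at h2
        exact h2
      -- `(A₂, -½ C Q)` is tangent to `W⁰`, where `C = A₂ Pᵀ + P A₂ᵀ`
      set C := mat A.2 * (mat x.1.2)ᵀ + mat x.1.2 * (mat A.2)ᵀ with hC
      have hCt : Cᵀ = C := by
        rw [hC, transpose_add, transpose_mul, transpose_mul, transpose_transpose,
          transpose_transpose, add_comm]
      have hQ : mat x.1.1 * (mat x.1.1)ᵀ = 1 := x.2.1
      have h3 := h0 (A.2, unmat ((-1 / 2 : ℝ) • (C * mat x.1.1)))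
        ((exists_wZeroIncl_eq_iff x _).2 ⟨h4, by
        change mat x.1.1 * ((-1 / 2 : ℝ) • (C * mat x.1.1))ᵀ +
          ((-1 / 2 : ℝ) • (C * mat x.1.1)) * (mat x.1.1)ᵀ + C = 0
        rw [transpose_smul, transpose_mul, hCt, Matrix.mul_smul, ← Matrix.mul_assoc, hQ,
          Matrix.one_mul, Matrix.smul_mul, Matrix.mul_assoc, hQ, Matrix.mul_one]
        module⟩)
      rw [hA1, trPair_zero_left, zero_sub, neg_eq_zero] at h3
      exact h3
    exact injective_wZeroIncl x ((Prod.ext hA1 hA2 : A = 0).trans (map_zero _).symm)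

end Symplectic

theorem mainTheorem1 (n N : ℕ) (hn : 1 ≤ n) (hnN : n ≤ N) :
    IsSymplectomorphism (phiMap n N) (wZeroForm n N)
      (canonicalForm 𝓘(ℝ, StiefelModel n N) (Stiefel n N)) := by
  refine MForm.isSymplectomorphism_of_pullback_oneForm (phiDiffeomorph n N) ?_
    (isSymplectic_wZeroForm n N) ?_
  · change (MForm.pullback (phiMap n N) _).IsSmooth
    rw [pullback_tautologicalForm]
    exact (isSmooth_ambientOneForm n N).pullback contMDiff_wZero_val
  · change (MForm.pullback (phiMap n N) _).d = _
    rw [pullback_tautologicalForm, d_wZeroOneForm]
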